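/- A metric space $X$ is CAT(0) if it is nonempty, any two of its points are joined by a geodesic segment, and every geodesic triangle in $X$ is at least as thin as its comparison triangle in the Euclidean plane (no completeness or finite-dimensionality is assumed). An action of a discrete group $G$ on $X$ is geometric if it is isometric, proper (every $x\in X$ has a ball $B(x,r)$, $r>0$, with $\{h\in G : hB(x,r)\cap B(x,r)\neq\emptyset\}$ finite) and cocompact ($X=G\cdot K$ for some compact $K\subseteq X$). For a group $\Gamma$, let $\mathrm{hd}_{\mathbb Q}(\Gamma)\in\{0,1,\dots,\infty\}$ be the flat dimension of the trivial $\mathbb Q[\Gamma]$-module $\mathbb Q$, and, for countable $\Gamma$, let $\operatorname{as-dim}(\Gamma)\in\{0,1,\dots,\infty\}$ be the asymptotic dimension of $\Gamma$ with respect to a proper left-invariant metric (any two such metrics give the same value). **Proposition.** Let a group $G$ act geometrically on a CAT(0) space, let $g\in G$ have infinite order, and let $C_g$ be the centralizer of $g$ in $G$. Then: 1. the reduced centralizer $C_g/\langle g\rangle$ has a subgroup of finite index that is isomorphic to a subgroup of $C_g$; 2. if $\mathrm{hd}_{\mathbb Q}(G)<\infty$, then $\mathrm{hd}_{\mathbb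 Q}(C_g/\langle g\rangle)<\infty$; 3. if $\operatorname{as-dim}(G)<\infty$, then $\operatorname{as-dim}(C_g/\langle g\rangle)<\infty$. -/

import Mathlib

open scoped TensorProduct

universe u v w

/-! ### CAT(0) spaces and geometric actions -/

/-- `S` is a geodesic segment joining `p` to `q`: the image of an isometric embedding of
`[0, dist p q]` that sends `0` to `p` and `dist p q` to `q`. -/
def IsGeodesicSegment {X : Type v} [MetricSpace X] (p q : X) (S : Set X) : Prop :=
  ∃ γ : ℝ → X, γ 0 = p ∧ γ (dist p q) = q ∧
    (∀ s ∈ Set.Icc 0 (dist p q), ∀ t ∈ Set.Icc 0 (dist p q), dist (γ s) (γ t) = |s - t|) ∧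
    γ '' Set.Icc 0 (dist p q) = S

/-- A (nonempty) CAT(0) space: a geodesic metric space in which every geodesic triangle is at
least as thin as its comparison triangle in the Euclidean plane.  The vertices `p`, `q`, `r` are
arbitrary, so the two sides `[p, q]`, `[p, r]` below stand for any two sides of the triangle. -/
structure IsCAT0 (X : Type v) [MetricSpace X] : Prop where
  nonempty : Nonempty X
  exists_geodesic : ∀ p q : X, ∃ S : Set X, IsGeodesicSegment p q S
  dist_le_comparison : ∀ (p q r : X) (Spq Spr Sqr : Set X),
    IsGeodesicSegment p q Spq → IsGeodesicSegment p r Spr → IsGeodesicSegment q r Sqr →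
    ∀ p' q' r' : EuclideanSpace ℝ (Fin 2),
      dist p' q' = dist p q → dist p' r' = dist p r → dist q' r' = dist q r →
      ∀ x ∈ Spq, ∀ y ∈ Spr, ∀ x' ∈ segment ℝ p' q', ∀ y' ∈ segment ℝ p' r',
        dist p' x' = dist p x → dist p' y' = dist p y → dist x y ≤ dist x' y'

/-- The action of the discrete group `G` on the metric space `X` is geometric: it is by
isometries, proper (every point has a ball that meets only finitely many of its translates) and
cocompact. -/
structure IsGeometricAction (G : Type u) (X : Type v) [Group G] [MetricSpace X] [MulAction G X] :
    Prop where
  dist_smul_smul : ∀ (g : G) (x y : X), dist (g • x) (g • y) = dist x y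
  proper : ∀ x : X, ∃ r > 0,
    {g : G | (((fun y => g • y) '' Metric.ball x r) ∩ Metric.ball x r).Nonempty}.Finite
  cocompact : ∃ K : Set X, IsCompact K ∧ ∀ x : X, ∃ g : G, ∃ y ∈ K, g • y = x

/-! ### Reduced centralizers -/

/-- The infinite cyclic (or finite cyclic) group `⟨g⟩`, as a subgroup of the centralizer `C_g`. -/
abbrev zpowersInCentralizer {G : Type u} [Group G] (g : G) :
    Subgroup (Subgroup.centralizer ({g} : Set G)) :=
  (Subgroup.zpowers g).subgroupOf (Subgroup.centralizer {g})

instance zpowersInCentralizer_normal {G : Type u} [Group G] (g : G) :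
    (zpowersInCentralizer g).Normal := by
  refine ⟨fun n hn c => ?_⟩
  obtain ⟨k, hk⟩ := Subgroup.mem_zpowers_iff.mp (Subgroup.mem_subgroupOf.mp hn)
  have hc : g * (c : G) = c * g := Subgroup.mem_centralizer_iff.mp c.2 g rfl
  have hck : (c : G) * g ^ k = g ^ k * c := ((show Commute (c : G) g from hc.symm).zpow_right k).eq
  refine Subgroup.mem_subgroupOf.mpr (Subgroup.mem_zpowers_iff.mpr ⟨k, ?_⟩)
  simp [← hk, hck]

/-- The reduced centralizer `C_g / ⟨g⟩`. -/
abbrev ReducedCentralizer {G : Type u} [Group G] (g : G) : Type u :=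
  Subgroup.centralizer ({g} : Set G) ⧸ zpowersInCentralizer g

/-! ### Flat modules over noncommutative rings and homological dimension of groups -/

section Flat

variable (S : Type w) [Ring S]

/-- The relations `n s ⊗ m = n ⊗ s m` that define `N ⊗_S M` as a quotient of `N ⊗_ℤ M`, where `N`
is a right and `M` a left `S`-module. -/
def balancedRelations (N M : Type w) [AddCommGroup N] [Module Sᵐᵒᵖ N] [AddCommGroup M]
    [Module S M] : AddSubgroup (N ⊗[ℤ] M) :=
  AddSubgroup.closure {z | ∃ (n : N) (s : S) (m : M),
    z = (MulOpposite.op s • n) ⊗ₜ[ℤ] m - n ⊗ₜ[ℤ] (s • m)}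

/-- The tensor product `N ⊗_S M` of a right `S`-module `N` and a left `S`-module `M`. -/
abbrev BalancedTensor (N M : Type w) [AddCommGroup N] [Module Sᵐᵒᵖ N] [AddCommGroup M]
    [Module S M] : Type w :=
  (N ⊗[ℤ] M) ⧸ balancedRelations S N M

/-- The map `f ⊗ id : N ⊗_S M → N' ⊗_S M` induced by a map `f : N → N'` of right `S`-modules. -/
def BalancedTensor.map {N N' : Type w} (M : Type w) [AddCommGroup N] [Module Sᵐᵒᵖ N]
    [AddCommGroup N'] [Module Sᵐᵒᵖ N'] [AddCommGroup M] [Module S M] (f : N →ₗ[Sᵐᵒᵖ] N') :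
    BalancedTensor S N M →+ BalancedTensor S N' M :=
  QuotientAddGroup.map _ _
    (TensorProduct.map f.toAddMonoidHom.toIntLinearMap
      (LinearMap.id : M →ₗ[ℤ] M)).toAddMonoidHom <| by
    refine (AddSubgroup.closure_le _).mpr ?_
    rintro _ ⟨n, s, m, rfl⟩
    refine AddSubgroup.subset_closure ⟨f n, s, m, ?_⟩
    simp

/-- A left `S`-module `M` is flat if `- ⊗_S M` preserves injectivity of maps of right
`S`-modules. -/
def IsFlatModule (M : Type w) [AddCommGroup M] [Module S M] : Prop :=
  ∀ (N N' : Type w) [AddCommGroup N] [Module Sᵐᵒᵖ N] [AddCommGroup N'] [Module Sᵐᵒᵖ N']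
    (f : N →ₗ[Sᵐᵒᵖ] N'), Function.Injective f → Function.Injective (BalancedTensor.map S M f)

/-- There is an exact sequence `0 → F_n → ⋯ → F_1 → F_0 → M → 0` of left `S`-modules with all
`F_i` flat. -/
def HasFlatResolution (M : Type v) [AddCommGroup M] [Module S M] (n : ℕ) : Prop :=
  ∃ (F : ℕ → ModuleCat.{w} S) (d : ∀ i, F (i + 1) →ₗ[S] F i) (ε : F 0 →ₗ[S] M),
    (∀ i, IsFlatModule S (F i)) ∧ (∀ i, n < i → Subsingleton (F i)) ∧
    Function.Surjective ε ∧ Function.Exact (d 0) ε ∧ ∀ i, Function.Exact (d (i + 1)) (d i)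

/-- The flat dimension of a left `S`-module: the least length of a flat resolution, `⊤` if there
is no finite one. -/
noncomputable def flatDimension (M : Type v) [AddCommGroup M] [Module S M] : ℕ∞ :=
  ⨅ (n : ℕ) (_ : HasFlatResolution S M n), (n : ℕ∞)

end Flat

/-- The homological dimension `hd_k(G)`: the flat dimension over the group ring `k[G]` of the
module `k` with the trivial action of `G`. -/
noncomputable def homologicalDimension (k : Type v) (G : Type u) [CommRing k] [Group G] : ℕ∞ :=
  flatDimension (MonoidAlgebra k G) (Representation.trivial k G k).asModule

/-! ### Asymptotic dimension -/

/-- The metric space `X` has asymptotic dimension at most `n`: for every `R > 0` there are `n + 1`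
families of uniformly bounded sets that together cover `X`, such that any two distinct members of
the same family are at distance more than `R` from each other. -/
def AsdimLE (X : Type u) [MetricSpace X] (n : ℕ) : Prop :=
  ∀ R : ℝ, 0 < R → ∃ (U : Fin (n + 1) → Set (Set X)) (D : ℝ),
    (∀ x, ∃ i, ∃ A ∈ U i, x ∈ A) ∧
    (∀ i, ∀ A ∈ U i, ∀ x ∈ A, ∀ y ∈ A, dist x y ≤ D) ∧
    ∀ i, ∀ A ∈ U i, ∀ B ∈ U i, A ≠ B → ∀ x ∈ A, ∀ y ∈ B, R < dist x y

/-- The asymptotic dimension of a metric space. -/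
noncomputable def asymptoticDimension (X : Type u) [MetricSpace X] : ℕ∞ :=
  ⨅ (n : ℕ) (_ : AsdimLE X n), (n : ℕ∞)

/-- A metric on the discrete group `G` that is left-invariant and proper (its balls are finite). -/
structure IsProperLeftInvariantMetric (G : Type u) [Group G] (m : MetricSpace G) : Prop where
  left_invariant : ∀ a x y : G, m.dist (a * x) (a * y) = m.dist x y
  proper : ∀ (x : G) (r : ℝ), {y : G | m.dist y x ≤ r}.Finite

/-- The asymptotic dimension of the discrete group `G`, computed with a proper left-invariant
metric.  Such a metric exists exactly when `G` is countable, and all of them are coarsely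
equivalent, so that they give the same value. -/
noncomputable def groupAsymptoticDimension (G : Type u) [Group G] : ℕ∞ :=
  ⨅ (m : MetricSpace G) (_ : IsProperLeftInvariantMetric G m), @asymptoticDimension G m

/-! Everything rests on a homomorphism `φ : C_g → ℤ` with `φ g ≠ 0`. Its kernel `N` meets `⟨g⟩`
trivially, and `N⟨g⟩ = φ⁻¹(⟨φ g⟩)` has finite index in `C_g`. So `N` embeds in `C_g / ⟨g⟩` with
finite index, while it is also a subgroup of `C_g ≤ G` (`exists_virtual_splitting`).

To get `φ`, first find a real character. The Bruhat–Tits midpoint inequality bounds the quasi-inner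
product, and a scaled average of the products of the displacement of `c` with those of the powers of
`g` becomes additive in `c ∈ C_g` in the limit (`exists_translation_hom`). At `g` the average
telescopes and dominates the square of a translation length, which is positive since powers of `g`
displace points linearly. The group `C_g` is finitely generated, because the points that `g` moves
no further than a base point form a midpoint-closed set on which `C_g` acts coarsely transitively
(`fg_centralizer`). Hence the image of the real character is free abelian of finite rank, and a
coordinate of it is `φ`. No axis of `g` is needed, so completeness plays no role.

Finiteness of both dimensions passes from `G` to its subgroup `N` and up to a finite index
overgroup. For asymptotic dimension this is a coarse embedding. For `hd_ℚ`, character modules turn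
flat into injective; injectives restrict along `ℚ[N] → ℚ[G]` by freeness, and averaging over the
cosets of `N` reflects injectivity to `ℚ[C_g / ⟨g⟩]`. -/

/-! ### Midpoints in CAT(0) spaces -/

/-- `m` is a midpoint of `a` and `b` in the sense of the inequality of Bruhat and Tits. -/
def IsCNMidpoint {X : Type v} [MetricSpace X] (a b m : X) : Prop :=
  ∀ z, dist z m ^ 2 ≤ dist z a ^ 2 / 2 + dist z b ^ 2 / 2 - dist a b ^ 2 / 4

/-- Three numbers that satisfy the triangle inequalities are the side lengths of a triangle in
the Euclidean plane. -/
theorem exists_euclidean_triangle {a b c : ℝ} (ha : 0 ≤ a) (hb : 0 ≤ b) (h₁ : a ≤ b + c)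
    (h₂ : b ≤ a + c) (h₃ : c ≤ a + b) :
    ∃ p q r : EuclideanSpace ℝ (Fin 2), dist p q = a ∧ dist p r = b ∧ dist q r = c := by
  have hc : 0 ≤ c := by linarith
  rcases ha.eq_or_lt with rfl | ha'
  · refine ⟨0, 0, !₂[b, 0], by simp, ?_, ?_⟩
    · simp [EuclideanSpace.dist_eq, Real.sqrt_sq_eq_abs, abs_of_nonneg hb]
    · have : b = c := by linarith
      subst this
      simp [EuclideanSpace.dist_eq, Real.sqrt_sq_eq_abs, abs_of_nonneg hb]
  · obtain ⟨s, hs⟩ : ∃ s : ℝ, 2 * a * s = b ^ 2 + a ^ 2 - c ^ 2 :=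
      ⟨(b ^ 2 + a ^ 2 - c ^ 2) / (2 * a), by field_simp⟩
    have hsb : s ^ 2 ≤ b ^ 2 := by
      refine sq_le_sq' ?_ ?_
      · nlinarith
      · nlinarith
    have ht : Real.sqrt (b ^ 2 - s ^ 2) ^ 2 = b ^ 2 - s ^ 2 := Real.sq_sqrt (by linarith)
    refine ⟨0, !₂[a, 0], !₂[s, Real.sqrt (b ^ 2 - s ^ 2)], ?_, ?_, ?_⟩
    · simp [EuclideanSpace.dist_eq, Real.sqrt_sq_eq_abs, abs_of_nonneg ha]
    · simp [EuclideanSpace.dist_eq, Real.dist_eq, ht, Real.sqrt_sq_eq_abs, abs_of_nonneg hb]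
    · have : (a - s) ^ 2 + (b ^ 2 - s ^ 2) = c ^ 2 := by linarith
      simp [EuclideanSpace.dist_eq, Real.dist_eq, ht, this, Real.sqrt_sq_eq_abs, abs_of_nonneg hc]

/-- The distance from a vertex to the midpoint of the opposite side is at most the Euclidean median,
whose length the parallelogram law gives. Later arguments use CAT(0) only through geodesics and this
inequality. -/
theorem IsCAT0.exists_cnMidpoint {X : Type v} [MetricSpace X] (hX : IsCAT0 X) (a b : X) :
    ∃ m, IsCNMidpoint a b m := by
  obtain ⟨S, hS⟩ := hX.exists_geodesic a b
  have hS' := hS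
  obtain ⟨γ, h0, h1, hγ, hγS⟩ := hS'
  have hmem : dist a b / 2 ∈ Set.Icc 0 (dist a b) :=
    ⟨by positivity, by linarith [dist_nonneg (x := a) (y := b)]⟩
  refine ⟨γ (dist a b / 2), fun z => ?_⟩
  obtain ⟨T, hT⟩ := hX.exists_geodesic a z
  obtain ⟨U, hU⟩ := hX.exists_geodesic b z
  obtain ⟨p, q, r, hpq, hpr, hqr⟩ := exists_euclidean_triangle (a := dist a b) (b := dist a z)
    (c := dist b z) dist_nonneg dist_nonneg (dist_triangle_right a b z) (dist_triangle a b z)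
    (dist_triangle_left b z a)
  have hzT : z ∈ T := by
    obtain ⟨η, -, h1', -, rfl⟩ := hT
    exact ⟨dist a z, ⟨dist_nonneg, le_rfl⟩, h1'⟩
  have key := hX.dist_le_comparison a b z S T U hS hT hU p q r hpq hpr hqr
    (γ (dist a b / 2)) (hγS ▸ Set.mem_image_of_mem γ hmem) z hzT (midpoint ℝ p q)
    (midpoint_mem_segment p q) r (right_mem_segment ℝ p r)
    (by
      have := hγ 0 ⟨le_rfl, dist_nonneg⟩ _ hmem
      rw [h0] at this
      rw [this, dist_left_midpoint, hpq]
      rw [zero_sub, abs_neg, abs_of_nonneg hmem.1]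
      norm_num
      ring) hpr
  have hpar : dist (midpoint ℝ p q) r ^ 2
      = dist z a ^ 2 / 2 + dist z b ^ 2 / 2 - dist a b ^ 2 / 4 := by
    have h := EuclideanGeometry.dist_sq_add_dist_sq_eq_two_mul_dist_midpoint_sq_add_half_dist_sq r p q
    rw [dist_comm r p, dist_comm r q, hpr, hqr, hpq, dist_comm r] at h
    rw [dist_comm z a, dist_comm z b]
    linarith
  rw [← hpar, dist_comm]
  gcongr

section CN

variable {X : Type v} [MetricSpace X]

theorem IsCNMidpoint.dist_left_le {a b m : X} (h : IsCNMidpoint a b m) :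
    dist a m ≤ dist a b / 2 := by
  have := h a
  rw [dist_self] at this
  refine abs_le_of_sq_le_sq' ?_ (by positivity) |>.2
  linarith

theorem IsCNMidpoint.symm {a b m : X} (h : IsCNMidpoint a b m) : IsCNMidpoint b a m := fun z => by
  have := h z
  rw [dist_comm b a]
  linarith

theorem IsCNMidpoint.dist_right_le {a b m : X} (h : IsCNMidpoint a b m) :
    dist m b ≤ dist a b / 2 := by
  rw [dist_comm m, dist_comm a]
  exact h.symm.dist_left_le

/-- The diagonals of a quadrilateral with vertices `a`, `b`, `d`, `c`. -/
theorem IsCNMidpoint.quadrilateral {a d m : X} (h : IsCNMidpoint a d m) (b c : X) :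
    dist a d ^ 2 + dist b c ^ 2
      ≤ dist a b ^ 2 + dist b d ^ 2 + dist d c ^ 2 + dist c a ^ 2 := by
  have hb := h b
  have hc := h c
  have ht : dist b c ≤ dist b m + dist c m := dist_triangle_right b c m
  have : dist b c ^ 2 ≤ 2 * dist b m ^ 2 + 2 * dist c m ^ 2 :=
    calc dist b c ^ 2 ≤ (dist b m + dist c m) ^ 2 := by gcongr
      _ ≤ _ := by nlinarith [sq_nonneg (dist b m - dist c m)]
  rw [dist_comm b a] at hb
  rw [dist_comm c d] at hc
  linarith

/-- The midpoint inequality for `m'` seen from `m`, and for `m` seen from `z`, combine so that all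
terms except `dist x z ^ 2 / 4` cancel. -/
theorem IsCNMidpoint.dist_midpoint_le {x y z m m' : X} (h : IsCNMidpoint x y m)
    (h' : IsCNMidpoint y z m') : dist m m' ≤ dist x z / 2 := by
  refine abs_le_of_sq_le_sq' ?_ (by positivity) |>.2
  have h1 := h' m
  have h2 := h z
  have h3 : dist m y ^ 2 ≤ (dist x y / 2) ^ 2 := by
    gcongr
    exact h.dist_right_le
  rw [dist_comm z m, dist_comm z x, dist_comm z y] at h2
  linarith

end CN

/-! ### Geometric actions are metrically proper -/

section Proper

variable {G : Type u} {X : Type v} [Group G] [MetricSpace X] [MulAction G X]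

/-- An isometric action with coarsely dense orbit of `p` in which only finitely many group
elements move `p` by a bounded amount. -/
structure IsCoarselyGeometric (G : Type u) {X : Type v} [Group G] [MetricSpace X] [MulAction G X]
    (p : X) : Prop where
  dist_smul_smul : ∀ (g : G) (x y : X), dist (g • x) (g • y) = dist x y
  dense : ∃ D, ∀ x, ∃ g : G, dist x (g • p) ≤ D
  finite : ∀ R : ℝ, {g : G | dist (g • p) p ≤ R}.Finite

/-- A Lebesgue number for the cover of the compact set `K` by the balls from properness works on
`K`; conjugation carries it to every translate of `K`. -/
theorem IsGeometricAction.exists_uniform_finite (hG : IsGeometricAction G X) :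
    ∃ ε > 0, ∀ x : X, {g : G | dist (g • x) x < ε}.Finite := by
  obtain ⟨K, hK, hGK⟩ := hG.cocompact
  choose r hr hfin using hG.proper
  obtain ⟨δ, hδ, hδK⟩ := lebesgue_number_lemma_of_metric hK (c := fun x => Metric.ball x (r x))
    (fun x => Metric.isOpen_ball)
    (fun x _ => Set.mem_iUnion.mpr ⟨x, Metric.mem_ball_self (hr x)⟩)
  refine ⟨δ, hδ, fun x => ?_⟩
  obtain ⟨h, k, hk, rfl⟩ := hGK x
  obtain ⟨i, hi⟩ := hδK k hk
  refine ((hfin i).image fun g => h * g * h⁻¹).subset fun g hg => ?_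
  refine ⟨h⁻¹ * g * h, ⟨(h⁻¹ * g * h) • k, ⟨k, hi (Metric.mem_ball_self hδ), rfl⟩, hi ?_⟩, by group⟩
  rw [Metric.mem_ball, ← hG.dist_smul_smul h, smul_smul]
  simpa [mul_assoc, mul_smul] using hg

theorem IsGeometricAction.exists_uniform_finite₂ (hG : IsGeometricAction G X) :
    ∃ ε > 0, ∀ x y : X, {g : G | dist (g • x) y < ε}.Finite := by
  obtain ⟨ε, hε, h⟩ := hG.exists_uniform_finite
  refine ⟨ε / 2, by positivity, fun x y => ?_⟩
  rcases Set.eq_empty_or_nonempty {g : G | dist (g • x) y < ε / 2} with h0 | ⟨g₀, hg₀⟩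
  · rw [h0]
    exact Set.finite_empty
  · refine ((h x).image fun g => g₀ * g).subset fun g hg => ⟨g₀⁻¹ * g, ?_, by group⟩
    rw [Set.mem_ofPred_eq, ← hG.dist_smul_smul g₀, smul_smul, mul_inv_cancel_left]
    have h₁ : dist (g₀ • x) y < ε / 2 := hg₀
    have h₂ : dist (g • x) y < ε / 2 := hg
    have := dist_triangle_right (g • x) (g₀ • x) y
    linarith

/-- Properness is only local, and balls of `X` are not known to be compact. Geodesics make it
global: a point at distance `(n + 1) * (ε / 2)` is a short step away from one at distance `n * (ε /
2)`, and each translate of `K` is near only finitely many others. -/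
theorem IsGeometricAction.exists_isCoarselyGeometric (hX : IsCAT0 X) (hG : IsGeometricAction G X) :
    ∃ p : X, IsCoarselyGeometric G p := by
  obtain ⟨ε₀, hε₀, hfin⟩ := hG.exists_uniform_finite₂
  obtain ⟨K, hK, hGK⟩ := hG.cocompact
  obtain ⟨x₀⟩ := hX.nonempty
  obtain ⟨-, p, hp, -⟩ := hGK x₀
  set ε := ε₀ / 2 with hε
  have hε0 : 0 < ε := by positivity
  obtain ⟨t, htK, ht, hcov⟩ := hK.finite_cover_balls (e := ε / 2) (by positivity)
  have hnet : ∀ k ∈ K, ∃ z ∈ t, dist k z < ε / 2 := fun k hk => by simpa using hcov hk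
  have hloc : ∀ x : X, {g : G | ∃ k ∈ K, dist (g • k) x ≤ ε}.Finite := fun x => by
    refine (ht.biUnion fun z _ => hfin z x).subset ?_
    rintro g ⟨k, hk, hg⟩
    obtain ⟨z, hz, hkz⟩ := hnet k hk
    refine Set.mem_biUnion hz ?_
    have := dist_triangle_left (g • z) x (g • k)
    rw [hG.dist_smul_smul] at this
    rw [Set.mem_ofPred_eq]
    linarith
  have hball : ∀ n : ℕ, {g : G | ∃ k ∈ K, dist p (g • k) ≤ n * (ε / 2)}.Finite := by
    intro n
    induction n with
    | zero =>
      refine (hloc p).subset ?_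
      rintro g ⟨k, hk, hg⟩
      refine ⟨k, hk, ?_⟩
      rw [dist_comm]
      refine hg.trans ?_
      simpa using hε0.le
    | succ n ih =>
      refine (ih.biUnion fun h _ => ht.biUnion fun z _ => hloc (h • z)).subset ?_
      rintro g ⟨k, hk, hg⟩
      obtain ⟨-, γ, h0, h1, hγ, -⟩ := hX.exists_geodesic p (g • k)
      set d := dist p (g • k)
      have hd : 0 ≤ d := dist_nonneg
      -- Walk back from `g • k` towards `p` by `ε / 2`, or to `p` itself if that is closer.
      set s := max 0 (d - ε / 2)
      have hs : s ∈ Set.Icc 0 d := ⟨le_max_left _ _, max_le hd (by linarith)⟩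
      have h₁ : dist p (γ s) ≤ n * (ε / 2) := by
        have := hγ 0 ⟨le_rfl, hd⟩ s hs
        rw [h0, zero_sub, abs_neg, abs_of_nonneg hs.1] at this
        rw [this]
        refine max_le (by positivity) ?_
        push_cast at hg
        linarith
      have h₂ : dist (γ s) (g • k) ≤ ε / 2 := by
        have := hγ s hs d ⟨hd, le_rfl⟩
        rw [h1, abs_sub_comm, abs_of_nonneg (by linarith [hs.2])] at this
        rw [this]
        have := le_max_right 0 (d - ε / 2)
        linarith
      obtain ⟨h, k', hk', hh⟩ := hGK (γ s)
      obtain ⟨z, hz, hkz⟩ := hnet k' hk'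
      refine Set.mem_biUnion (x := h) ⟨k', hk', hh ▸ h₁⟩ (Set.mem_biUnion hz ⟨k, hk, ?_⟩)
      have := dist_triangle_left (g • k) (h • z) (h • k')
      rw [hG.dist_smul_smul, hh] at this
      linarith
  refine ⟨p, hG.dist_smul_smul, ?_, fun R => ?_⟩
  · obtain ⟨D, hD⟩ := hK.isBounded.subset_closedBall p
    refine ⟨D, fun x => ?_⟩
    obtain ⟨g, k, hk, rfl⟩ := hGK x
    exact ⟨g, by rw [hG.dist_smul_smul]; exact hD hk⟩
  · obtain ⟨n, hn⟩ := exists_nat_ge (R / (ε / 2))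
    refine (hball n).subset fun g hg => ⟨p, hp, ?_⟩
    rw [dist_comm]
    exact (show dist (g • p) p ≤ R from hg).trans ((div_le_iff₀ (by positivity)).mp hn)

end Proper

namespace IsCoarselyGeometric

variable {G : Type u} {X : Type v} [Group G] [MetricSpace X] [MulAction G X] {p : X}

theorem dist_pow_smul_le (hp : IsCoarselyGeometric G p) (g : G) (x : X) (n : ℕ) :
    dist x (g ^ n • x) ≤ n * dist x (g • x) := by
  induction n with
  | zero => simp
  | succ n ih =>
    have := dist_triangle x (g ^ n • x) (g ^ (n + 1) • x)
    rw [pow_succ, mul_smul, hp.dist_smul_smul] at this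
    rw [pow_succ, mul_smul]
    push_cast
    linarith

/-- The displacement of an element of infinite order is bounded away from zero. -/
theorem exists_le_dist_smul (hp : IsCoarselyGeometric G p) {g : G} (hg : ¬ IsOfFinOrder g) :
    ∃ δ > 0, ∀ x : X, δ ≤ dist x (g • x) := by
  obtain ⟨D, hD⟩ := hp.dense
  have hfin := hp.finite (2 * D + 1)
  set M := hfin.toFinset.card
  -- If `g` moved `x` by less than this, the `M + 1` powers from `0` to `M` of a conjugate of `g`
  -- would all lie in a set of `M` elements, so two would coincide.
  refine ⟨1 / (M + 1), by positivity, fun x => ?_⟩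
  by_contra! hx
  obtain ⟨h, hh⟩ := hD x
  have hmem : ∀ n ∈ Finset.range (M + 1), (h⁻¹ * g * h) ^ n ∈ hfin.toFinset := by
    intro n hn
    rw [Set.Finite.mem_toFinset, Set.mem_ofPred_eq]
    have hn' : (n : ℝ) ≤ M + 1 := by exact_mod_cast (Finset.mem_range.mp hn).le
    have hpow : (h⁻¹ * g * h) ^ n = h⁻¹ * g ^ n * h := by
      simpa using conj_pow (i := n) (a := h⁻¹) (b := g)
    have h₁ : dist x (g ^ n • x) ≤ 1 := by
      refine (hp.dist_pow_smul_le g x n).trans ?_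
      calc n * dist x (g • x) ≤ (M + 1) * (1 / (M + 1)) := by gcongr
        _ = 1 := by field_simp
    have h₂ : dist ((h⁻¹ * g * h) ^ n • p) p = dist (g ^ n • h • p) (h • p) := by
      rw [hpow, ← hp.dist_smul_smul h]
      simp [mul_smul]
    have h₃ := dist_triangle4 (g ^ n • h • p) (g ^ n • x) x (h • p)
    rw [hp.dist_smul_smul, dist_comm _ x, dist_comm _ x] at h₃
    rw [h₂]
    linarith
  obtain ⟨i, hi, j, hj, hij, heq⟩ := Finset.exists_ne_map_eq_of_card_lt_of_maps_to
    (s := Finset.range (M + 1)) (t := hfin.toFinset) (by simp [M]) hmem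
  have hfo : IsOfFinOrder (h⁻¹ * g * h) := by
    by_contra hcon
    exact hij (injective_pow_iff_not_isOfFinOrder.mpr hcon heq)
  refine hg ?_
  have := (MulAut.conj h).toMonoidHom.isOfFinOrder hfo
  simpa [mul_assoc] using this

theorem isCNMidpoint_smul (hp : IsCoarselyGeometric G p) (g : G) {x y m : X}
    (hm : IsCNMidpoint x y m) : IsCNMidpoint (g • x) (g • y) (g • m) := fun z => by
  have := hm (g⁻¹ • z)
  rw [← hp.dist_smul_smul g, ← hp.dist_smul_smul g (g⁻¹ • z) x,
    ← hp.dist_smul_smul g (g⁻¹ • z) y] at this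
  simpa [hp.dist_smul_smul] using this

/-- Convexity of the displacement function: go from `m` to `g • m` through a midpoint of `y` and `g
• x`. -/
theorem dist_midpoint_smul_le (hp : IsCoarselyGeometric G p)
    (hX : ∀ a b : X, ∃ m, IsCNMidpoint a b m) (g : G) {x y m : X} (hm : IsCNMidpoint x y m) :
    dist m (g • m) ≤ dist x (g • x) / 2 + dist y (g • y) / 2 := by
  obtain ⟨m', hm'⟩ := hX y (g • x)
  have h₁ := hm.dist_midpoint_le hm'
  have h₂ := hm'.dist_midpoint_le (hp.isCNMidpoint_smul g hm)
  have := dist_triangle m m' (g • m)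
  linarith

/-- Squaring doubles a lower bound on displacement: if `m` is a midpoint of `x` and `f • x`, then `f
• m` is one of `f • x` and `f ^ 2 • x`, so `f` moves `m` at most half as far as `f ^ 2` moves `x`.
-/
theorem mul_le_dist_pow_smul (hp : IsCoarselyGeometric G p)
    (hX : ∀ a b : X, ∃ m, IsCNMidpoint a b m) {δ : ℝ} {k : ℕ} {g : G}
    (hδ : ∀ x : X, δ ≤ dist x (g • x)) (x : X) : 2 ^ k * δ ≤ dist x (g ^ 2 ^ k • x) := by
  induction k generalizing x with
  | zero => simpa using hδ x
  | succ k ih =>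
    set f := g ^ 2 ^ k
    obtain ⟨m, hm⟩ := hX x (f • x)
    have h := hm.dist_midpoint_le (hp.isCNMidpoint_smul f hm)
    have := ih m
    rw [show g ^ 2 ^ (k + 1) = f * f by rw [pow_succ, pow_mul, pow_two], mul_smul, pow_succ]
    linarith

end IsCoarselyGeometric

/-! ### Centralizers are finitely generated -/

namespace IsCoarselyGeometric

variable {G : Type u} {X : Type v} [Group G] [MetricSpace X] [MulAction G X] {p : X}

/-- The orbit of `p` under the centralizer of `g` is coarsely dense in the set of points that `g`
moves at most as far as `p`. -/
theorem exists_centralizer_dense (hp : IsCoarselyGeometric G p) (g : G) :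
    ∃ D, ∀ x : X, dist x (g • x) ≤ dist p (g • p) →
      ∃ c : Subgroup.centralizer ({g} : Set G), dist x ((c : G) • p) ≤ D := by
  obtain ⟨D, hD⟩ := hp.dense
  set F := {f : G | dist (f • p) p ≤ 2 * D + dist p (g • p)}
  have hF : F.Finite := hp.finite _
  -- The conjugator `k f` depends on the conjugate `f` alone. If `x` is near `h • p`, then `f = h⁻¹
  -- * g * h` lies in the finite set `F`, and `h * (k f)⁻¹` centralizes `g` and differs from `h` by
  -- one of finitely many elements.
  have hsel : ∀ f : G, ∃ k : G, (∃ h : G, h⁻¹ * g * h = f) → k⁻¹ * g * k = f := fun f => by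
    by_cases hf : ∃ h : G, h⁻¹ * g * h = f
    · exact ⟨hf.choose, fun _ => hf.choose_spec⟩
    · exact ⟨1, fun h => absurd h hf⟩
  choose k hk using hsel
  obtain ⟨E, hE⟩ := (hF.image fun f => dist p ((k f)⁻¹ • p)).bddAbove
  refine ⟨D + E, fun x hx => ?_⟩
  obtain ⟨h, hh⟩ := hD x
  have hf : h⁻¹ * g * h ∈ F := by
    have h₁ : dist ((h⁻¹ * g * h) • p) p = dist (g • h • p) (h • p) := by
      rw [← hp.dist_smul_smul h]
      simp [mul_smul]
    have h₂ := dist_triangle4 (g • h • p) (g • x) x (h • p)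
    rw [hp.dist_smul_smul, dist_comm _ x, dist_comm _ x] at h₂
    rw [Set.mem_ofPred_eq, h₁]
    linarith
  have hkf := hk _ ⟨h, rfl⟩
  set f := h⁻¹ * g * h with hfdef
  refine ⟨⟨h * (k f)⁻¹, ?_⟩, ?_⟩
  · rw [Subgroup.mem_centralizer_singleton_iff]
    have h₁ : (k f)⁻¹ * g = f * (k f)⁻¹ := by
      nth_rewrite 2 [← hkf]
      group
    have h₂ : g * h = h * f := by
      rw [hfdef]
      group
    rw [mul_assoc, h₁, ← mul_assoc g, h₂]
    exact (mul_assoc _ _ _).symm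
  · have h₁ : dist p ((k f)⁻¹ • p) ≤ E := hE (Set.mem_image_of_mem _ hf)
    have h₂ := dist_triangle x (h • p) ((h * (k f)⁻¹) • p)
    rw [mul_smul, hp.dist_smul_smul] at h₂
    rw [mul_smul]
    linarith

/-- By convexity, the points that `g` moves at most as far as `p` are closed under midpoints.
Repeated bisection joins two of them by a chain with steps of length at most `1`, and centralizer
elements near consecutive points differ by an element of `S`. -/
theorem fg_centralizer (hp : IsCoarselyGeometric G p) (hX : ∀ a b : X, ∃ m, IsCNMidpoint a b m)
    (g : G) : Group.FG (Subgroup.centralizer ({g} : Set G)) := by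
  obtain ⟨D, hD⟩ := hp.exists_centralizer_dense g
  set C := Subgroup.centralizer ({g} : Set G)
  set S := {c : C | dist ((c : G) • p) p ≤ 2 * D + 1}
  have hS : S.Finite := Set.Finite.of_finite_image
    ((hp.finite (2 * D + 1)).subset (by rintro _ ⟨c, hc, rfl⟩; exact hc))
    (Subtype.val_injective.injOn)
  have key : ∀ n : ℕ, ∀ x y : X, dist x (g • x) ≤ dist p (g • p) →
      dist y (g • y) ≤ dist p (g • p) → dist x y ≤ 2 ^ n → ∀ c d : C,
      dist x ((c : G) • p) ≤ D → dist y ((d : G) • p) ≤ D → c⁻¹ * d ∈ Subgroup.closure S := by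
    intro n
    induction n with
    | zero =>
      intro x y _ _ hxy c d hc hd
      refine Subgroup.subset_closure ?_
      have h₁ : dist ((c⁻¹ * d : C) • p) p = dist ((d : G) • p) ((c : G) • p) := by
        rw [Subgroup.smul_def, ← hp.dist_smul_smul (c : G)]
        simp [mul_smul]
      have h₂ := dist_triangle4 ((d : G) • p) y x ((c : G) • p)
      rw [dist_comm _ y, dist_comm y x] at h₂
      rw [pow_zero] at hxy
      change dist ((c⁻¹ * d : C) • p) p ≤ _
      rw [h₁]
      linarith
    | succ n ih =>
      intro x y hx hy hxy c d hc hd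
      obtain ⟨m, hm⟩ := hX x y
      have hgm : dist m (g • m) ≤ dist p (g • p) := by
        have := hp.dist_midpoint_smul_le hX g hm
        linarith
      obtain ⟨e, he⟩ := hD m hgm
      rw [pow_succ] at hxy
      have h₁ := ih x m hx hgm (by linarith [hm.dist_left_le]) c e hc he
      have h₂ := ih m y hgm hy (by linarith [hm.dist_right_le]) e d he hd
      simpa [mul_assoc] using mul_mem h₁ h₂
  refine ⟨Subgroup.fg_iff _ |>.mpr ⟨S, ?_, hS⟩⟩
  refine eq_top_iff.mpr fun c _ => ?_
  obtain ⟨a, ha⟩ := hD p le_rfl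
  have hdisp : ∀ b : C, dist ((b : G) • p) (g • (b : G) • p) = dist p (g • p) := fun b => by
    rw [smul_smul, ← Subgroup.mem_centralizer_singleton_iff.mp b.2, mul_smul, hp.dist_smul_smul]
  have hmem : ∀ b : C, a⁻¹ * (b * a) ∈ Subgroup.closure S := fun b => by
    obtain ⟨n, hn⟩ := pow_unbounded_of_one_lt (dist p ((b : G) • p)) one_lt_two
    refine key n p ((b : G) • p) le_rfl (hdisp b).le hn.le a (b * a) ha ?_
    rw [Subgroup.coe_mul, mul_smul, hp.dist_smul_smul]
    exact ha
  -- The chain starts at the coset representative `a` rather than at `1`; applying `hmem` to a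
  -- conjugate undoes this.
  simpa [mul_assoc] using hmem (a * c * a⁻¹)

end IsCoarselyGeometric

/-! ### The translation homomorphism on a centralizer -/

/-- Twice the quasi-inner product of the bound vectors from `a` to `b` and from `c` to `d`. -/
def quasiInner {X : Type v} [MetricSpace X] (a b c d : X) : ℝ :=
  dist a d ^ 2 + dist b c ^ 2 - dist a c ^ 2 - dist b d ^ 2

section QuasiInner

variable {X : Type v} [MetricSpace X]

theorem quasiInner_add_left (a b e c d : X) :
    quasiInner a b c d + quasiInner b e c d = quasiInner a e c d := by
  unfold quasiInner
  ring

theorem quasiInner_add_right (a b c d e : X) :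
    quasiInner a b c d + quasiInner a b d e = quasiInner a b c e := by
  unfold quasiInner
  ring

/-- The two signs are the quadrilateral inequality for the two ways of choosing the diagonals. This
weak form of the Cauchy–Schwarz inequality suffices, since errors are later divided by `N`. -/
theorem abs_quasiInner_le (hX : ∀ a b : X, ∃ m, IsCNMidpoint a b m) (a b c d : X) :
    |quasiInner a b c d| ≤ dist a b ^ 2 + dist c d ^ 2 := by
  obtain ⟨m, hm⟩ := hX a d
  obtain ⟨m', hm'⟩ := hX b d
  have h₁ := hm.quadrilateral b c
  have h₂ := hm'.quadrilateral a c
  unfold quasiInner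
  rw [dist_comm c a, dist_comm d c] at h₁
  rw [dist_comm d c, dist_comm c b, dist_comm b a] at h₂
  rw [abs_le]
  constructor <;> linarith

/-- A crude bound for the quasi-inner product that holds in all metric spaces. -/
theorem abs_quasiInner_self_le (a b d : X) :
    |quasiInner a b a d| ≤ 2 * dist a b ^ 2 + 2 * dist a b * dist a d := by
  have h₁ := dist_triangle_left b d a
  have h₂ := dist_triangle a b d
  have h₃ : 0 ≤ dist a b := dist_nonneg
  have h₄ : 0 ≤ dist a d := dist_nonneg
  have h₅ : 0 ≤ dist b d := dist_nonneg
  unfold quasiInner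
  rw [dist_self, dist_comm b a, abs_le]
  constructor <;> nlinarith

end QuasiInner

namespace IsCoarselyGeometric

variable {G : Type u} {X : Type v} [Group G] [MetricSpace X] [MulAction G X] {p : X}

theorem quasiInner_smul (hp : IsCoarselyGeometric G p) (g : G) (a b c d : X) :
    quasiInner (g • a) (g • b) (g • c) (g • d) = quasiInner a b c d := by
  simp [quasiInner, hp.dist_smul_smul]

/-- The mean over `n ≤ N`, divided by `N`, of the quasi-inner products of the displacements of `p`
by `c` and by `g ^ n`. -/
noncomputable def meanTranslation (p : X) (g c : G) (N : ℕ) : ℝ :=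
  (∑ n ∈ Finset.range N, quasiInner p (c • p) p (g ^ (n + 1) • p)) / (N : ℝ) ^ 2

/-- The summands grow at most linearly in `n`, which is why the sum is divided by `N ^ 2`. The bound
is independent of `N`, so limits along an ultrafilter exist. -/
theorem abs_meanTranslation_le (hp : IsCoarselyGeometric G p) (g c : G) (N : ℕ) :
    |meanTranslation p g c N|
      ≤ 2 * dist p (c • p) ^ 2 + 2 * dist p (c • p) * dist p (g • p) := by
  rcases N.eq_zero_or_pos with rfl | hN
  · simp only [meanTranslation, Finset.range_zero, Finset.sum_empty, zero_div, abs_zero]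
    positivity
  have hN' : (1 : ℝ) ≤ N := by exact_mod_cast hN
  rw [meanTranslation, abs_div, abs_of_nonneg (by positivity : (0 : ℝ) ≤ (N : ℝ) ^ 2),
    div_le_iff₀ (by positivity)]
  have hb : ∀ n ∈ Finset.range N, |quasiInner p (c • p) p (g ^ (n + 1) • p)|
      ≤ N * (2 * dist p (c • p) ^ 2 + 2 * dist p (c • p) * dist p (g • p)) := by
    intro n hn
    refine (abs_quasiInner_self_le _ _ _).trans ?_
    have h₁ : dist p (g ^ (n + 1) • p) ≤ N * dist p (g • p) := by
      refine (hp.dist_pow_smul_le g p (n + 1)).trans ?_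
      gcongr
      exact Finset.mem_range.mp hn
    calc _ ≤ 1 * (2 * dist p (c • p) ^ 2) + 2 * dist p (c • p) * (N * dist p (g • p)) := by
          rw [one_mul]; gcongr
      _ ≤ N * (2 * dist p (c • p) ^ 2) + 2 * dist p (c • p) * (N * dist p (g • p)) := by gcongr
      _ = _ := by ring
  refine (Finset.abs_sum_le_sum_abs _ _).trans ((Finset.sum_le_card_nsmul _ _ _ hb).trans ?_)
  rw [Finset.card_range, nsmul_eq_mul]
  exact le_of_eq (by ring)

/-- Split the displacement of `c * d` at `c • p` and translate the second piece back by `c⁻¹`. As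
`c` commutes with `g`, this only shifts both ends of the vector from `p` to `g ^ (n + 1) • p` by
`dist p (c⁻¹ • p)`. The error in each summand is thus bounded independently of `n`. -/
theorem abs_meanTranslation_mul_sub_le (hp : IsCoarselyGeometric G p)
    (hX : ∀ a b : X, ∃ m, IsCNMidpoint a b m) {g c : G} (hc : Commute c g) (d : G) (N : ℕ) :
    |meanTranslation p g (c * d) N - (meanTranslation p g c N + meanTranslation p g d N)|
      ≤ 2 * (dist p (d • p) ^ 2 + dist p (c⁻¹ • p) ^ 2) / N := by
  rcases N.eq_zero_or_pos with rfl | hN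
  · simp [meanTranslation]
  have hN' : (0 : ℝ) < N := by exact_mod_cast hN
  have hb : ∀ n ∈ Finset.range N, |quasiInner p ((c * d) • p) p (g ^ (n + 1) • p)
      - (quasiInner p (c • p) p (g ^ (n + 1) • p) + quasiInner p (d • p) p (g ^ (n + 1) • p))|
      ≤ 2 * (dist p (d • p) ^ 2 + dist p (c⁻¹ • p) ^ 2) := by
    intro n _
    set q := g ^ (n + 1) • p with hq
    have h₁ : quasiInner (c • p) ((c * d) • p) p q
        = quasiInner p (d • p) (c⁻¹ • p) (g ^ (n + 1) • c⁻¹ • p) := by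
      rw [← hp.quasiInner_smul c⁻¹, smul_smul, smul_smul, inv_mul_cancel, inv_mul_cancel_left,
        one_smul, hq, smul_smul, smul_smul, (hc.inv_left.pow_right (n + 1)).eq]
    rw [← quasiInner_add_left p (c • p) ((c * d) • p), h₁,
      ← quasiInner_add_right p (d • p) (c⁻¹ • p) p, ← quasiInner_add_right p (d • p) p q]
    have h₂ := abs_quasiInner_le hX p (d • p) (c⁻¹ • p) p
    have h₃ := abs_quasiInner_le hX p (d • p) q (g ^ (n + 1) • c⁻¹ • p)
    rw [hq, hp.dist_smul_smul, ← hq] at h₃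
    rw [dist_comm _ p] at h₂
    rw [abs_le] at *
    constructor <;> linarith
  have hsum : meanTranslation p g (c * d) N - (meanTranslation p g c N + meanTranslation p g d N)
      = (∑ n ∈ Finset.range N, (quasiInner p ((c * d) • p) p (g ^ (n + 1) • p)
        - (quasiInner p (c • p) p (g ^ (n + 1) • p)
          + quasiInner p (d • p) p (g ^ (n + 1) • p)))) / (N : ℝ) ^ 2 := by
    simp only [meanTranslation, Finset.sum_sub_distrib, Finset.sum_add_distrib]
    ring
  rw [hsum, abs_div, abs_of_nonneg (by positivity : (0 : ℝ) ≤ (N : ℝ) ^ 2),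
    div_le_div_iff₀ (by positivity) hN']
  have := (Finset.abs_sum_le_sum_abs _ _).trans (Finset.sum_le_card_nsmul _ _ _ hb)
  rw [Finset.card_range, nsmul_eq_mul] at this
  calc _ ≤ (N * (2 * (dist p (d • p) ^ 2 + dist p (c⁻¹ • p) ^ 2))) * N := by gcongr
    _ = _ := by ring

/-- For `c = g` the summands telescope, up to a nonnegative constant in each; this is the gain from
averaging over `n`. -/
theorem sq_le_meanTranslation_self (hp : IsCoarselyGeometric G p) (g : G) (N : ℕ) :
    (dist p (g ^ N • p) / N) ^ 2 ≤ meanTranslation p g g N := by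
  have hterm : ∀ n : ℕ, quasiInner p (g • p) p (g ^ (n + 1) • p)
      = (dist p (g ^ (n + 1) • p) ^ 2 - dist p (g ^ n • p) ^ 2) + dist p (g • p) ^ 2 := by
    intro n
    have : dist (g • p) (g ^ (n + 1) • p) = dist p (g ^ n • p) := by
      rw [pow_succ', mul_smul, hp.dist_smul_smul]
    rw [quasiInner, this, dist_self, dist_comm (g • p) p]
    ring
  rw [meanTranslation, div_pow]
  gcongr
  simp only [hterm, Finset.sum_add_distrib, Finset.sum_range_sub
    (fun n => dist p (g ^ n • p) ^ 2)]
  have : 0 ≤ ∑ n ∈ Finset.range N, dist p (g • p) ^ 2 := Finset.sum_nonneg fun _ _ => by positivity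
  simpa using this

/-- The centralizer of `g` acts by translations in the direction of `g`. -/
theorem exists_translation_hom (hp : IsCoarselyGeometric G p)
    (hX : ∀ a b : X, ∃ m, IsCNMidpoint a b m) {g : G} (hg : ¬ IsOfFinOrder g) :
    ∃ τ : Subgroup.centralizer ({g} : Set G) →* Multiplicative ℝ,
      ∀ c : Subgroup.centralizer ({g} : Set G), (c : G) = g → τ c ≠ 1 := by
  obtain ⟨δ, hδ, hgδ⟩ := hp.exists_le_dist_smul hg
  set U : Ultrafilter ℕ := Filter.hyperfilter ℕ
  have hU : (U : Filter ℕ) ≤ Filter.atTop := Nat.hyperfilter_le_atTop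
  -- Only `N = 2 ^ k` is used, since the linear growth of displacement is known for these powers.
  have hlim : ∀ c : G, ∃ t : ℝ,
      Filter.Tendsto (fun k : ℕ => meanTranslation p g c (2 ^ k)) U (nhds t) := fun c => by
    set B := 2 * dist p (c • p) ^ 2 + 2 * dist p (c • p) * dist p (g • p)
    obtain ⟨t, -, ht⟩ := (isCompact_Icc (a := -B) (b := B)).ultrafilter_le_nhds
      (U.map fun k : ℕ => meanTranslation p g c (2 ^ k)) (by
        refine Filter.le_principal_iff.mpr (Filter.mem_map.mpr (Filter.univ_mem' fun k => ?_))
        exact abs_le.mp (hp.abs_meanTranslation_le g c (2 ^ k)))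
    exact ⟨t, ht⟩
  choose τ hτ using hlim
  have hmul : ∀ c d : G, Commute c g → τ (c * d) = τ c + τ d := fun c d hc => by
    have h₁ := (hτ (c * d)).sub ((hτ c).add (hτ d))
    have h₂ : Filter.Tendsto (fun k : ℕ => 2 * (dist p (d • p) ^ 2 + dist p (c⁻¹ • p) ^ 2)
        / ((2 ^ k : ℕ) : ℝ)) U (nhds 0) := by
      refine Filter.Tendsto.mono_left ?_ hU
      refine Filter.Tendsto.div_atTop tendsto_const_nhds ?_
      push_cast
      exact tendsto_pow_atTop_atTop_of_one_lt one_lt_two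
    have h₃ := tendsto_nhds_unique h₁ (squeeze_zero_norm
      (fun k => hp.abs_meanTranslation_mul_sub_le hX hc d (2 ^ k)) h₂)
    linarith
  have hpos : 0 < τ g := by
    refine lt_of_lt_of_le (by positivity : 0 < δ ^ 2) (ge_of_tendsto (hτ g) ?_)
    refine Filter.Eventually.of_forall fun k => le_trans ?_ (hp.sq_le_meanTranslation_self g _)
    gcongr
    rw [le_div_iff₀ (by positivity), mul_comm]
    push_cast
    exact hp.mul_le_dist_pow_smul hX hgδ p
  refine ⟨MonoidHom.mk' (fun c => Multiplicative.ofAdd (τ c)) fun c d => ?_, ?_⟩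
  · rw [← ofAdd_add, ← hmul _ _ (Subgroup.mem_centralizer_singleton_iff.mp c.2)]
    rfl
  · rintro c hc h
    have : τ c = 0 := h
    rw [hc] at this
    exact hpos.ne' this

end IsCoarselyGeometric

/-- A finitely generated group with a real character that does not vanish at `c` has an integral
one. -/
theorem exists_int_hom_of_real_hom {C : Type u} [Group C] [Group.FG C]
    (τ : C →* Multiplicative ℝ) {c : C} (hc : τ c ≠ 1) :
    ∃ φ : C →* Multiplicative ℤ, φ c ≠ 1 := by
  let A : AddSubgroup ℝ := Subgroup.toAddSubgroup' τ.range
  have hfg : Group.FG τ.range := Group.fg_range τ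
  have hA : AddGroup.FG A := AddGroup.fg_iff_mul_fg.mpr hfg
  have : Module.Finite ℤ A := Module.Finite.iff_addGroup_fg.mpr hA
  -- The image of `τ` is finitely generated and torsion-free, hence free, so some coordinate of `τ
  -- c` is nonzero.
  have : Module.Free ℤ A := Module.free_of_finite_type_torsion_free'
  let b := Module.Free.chooseBasis ℤ A
  let a : C →* Multiplicative A := MonoidHom.mk'
    (fun x => Multiplicative.ofAdd ⟨Multiplicative.toAdd (τ x), ⟨x, rfl⟩⟩) fun x y => by
      rw [← ofAdd_add]
      congr 1
      ext
      simp
  have hac : Multiplicative.toAdd (a c) ≠ 0 := fun h => hc (congrArg Subtype.val h)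
  obtain ⟨i, hi⟩ : ∃ i, b.repr (Multiplicative.toAdd (a c)) i ≠ 0 := by
    by_contra! h
    exact hac (b.repr.map_eq_zero_iff.mp (Finsupp.ext h))
  exact ⟨(AddMonoidHom.toMultiplicative (b.coord i).toAddMonoidHom).comp a, hi⟩

/-! ### Flat modules and injective character modules -/

section Character

variable (S : Type w) [Ring S]

/-- The character module of a left module is a right module. -/
noncomputable instance CharacterModule.rightModule (M : Type v) [AddCommGroup M] [Module S M] :
    Module Sᵐᵒᵖ (CharacterModule M) where
  smul s χ := AddMonoidHom.comp χ (DistribSMul.toAddMonoidHom M s.unop)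
  one_smul χ := by ext m; exact congrArg χ (one_smul S m)
  mul_smul s t χ := by ext m; exact congrArg χ (mul_smul t.unop s.unop m)
  smul_zero s := rfl
  smul_add s χ ψ := rfl
  add_smul s t χ := by
    ext m
    exact (congrArg χ (add_smul s.unop t.unop m)).trans (map_add χ _ _)
  zero_smul χ := by ext m; exact (congrArg χ (zero_smul S m)).trans (map_zero χ)

variable {S}

/-- Precomposition with a map of left modules, as a map of right modules. -/
noncomputable def CharacterModule.precomp {M M' : Type v} [AddCommGroup M] [Module S M]
    [AddCommGroup M'] [Module S M'] (f : M →ₗ[S] M') :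
    CharacterModule M' →ₗ[Sᵐᵒᵖ] CharacterModule M where
  toFun χ := AddMonoidHom.comp χ f.toAddMonoidHom
  map_add' _ _ := rfl
  map_smul' s χ := by
    ext m
    exact congrArg χ (f.map_smul s.unop m).symm

theorem CharacterModule.precomp_surjective {M M' : Type v} [AddCommGroup M] [Module S M]
    [AddCommGroup M'] [Module S M'] {f : M →ₗ[S] M'} (hf : Function.Injective f) :
    Function.Surjective (CharacterModule.precomp f) := fun χ => by
  obtain ⟨ψ, hψ⟩ := CharacterModule.dual_surjective_of_injective (R := ℤ)
    f.toAddMonoidHom.toIntLinearMap hf χ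
  exact ⟨ψ, hψ⟩

theorem CharacterModule.precomp_injective {M M' : Type v} [AddCommGroup M] [Module S M]
    [AddCommGroup M'] [Module S M'] {f : M →ₗ[S] M'} (hf : Function.Surjective f) :
    Function.Injective (CharacterModule.precomp f) :=
  CharacterModule.dual_injective_of_surjective (R := ℤ) f.toAddMonoidHom.toIntLinearMap hf

theorem CharacterModule.precomp_exact {M₁ M₂ M₃ : Type v} [AddCommGroup M₁] [Module S M₁]
    [AddCommGroup M₂] [Module S M₂] [AddCommGroup M₃] [Module S M₃] {f : M₁ →ₗ[S] M₂}
    {g : M₂ →ₗ[S] M₃} (hfg : Function.Exact f g) (hg : Function.Surjective g) :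
    Function.Exact (CharacterModule.precomp g) (CharacterModule.precomp f) := fun χ => by
  constructor
  · intro h
    have hker : ∀ x, g x = 0 → χ x = 0 := fun x hx => by
      obtain ⟨y, rfl⟩ := (hfg x).mp hx
      exact congrArg (fun ψ : CharacterModule M₁ => ψ y) h
    let χ' : M₂ →+ AddCircle (1 : ℚ) := χ
    let ψ : M₃ →+ AddCircle (1 : ℚ) :=
      (QuotientAddGroup.lift g.toAddMonoidHom.ker χ' fun x hx => hker x hx).comp
        (QuotientAddGroup.quotientKerEquivOfSurjective g.toAddMonoidHom hg).symm.toAddMonoidHom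
    refine ⟨ψ, ?_⟩
    ext x
    have hx : (QuotientAddGroup.quotientKerEquivOfSurjective g.toAddMonoidHom hg).symm (g x)
        = (x : M₂ ⧸ g.toAddMonoidHom.ker) := by
      rw [AddEquiv.symm_apply_eq]
      rfl
    exact congrArg (QuotientAddGroup.lift g.toAddMonoidHom.ker χ' fun x hx => hker x hx) hx
  · rintro ⟨ψ, rfl⟩
    ext x
    exact (congrArg ψ (hfg.apply_apply_eq_zero x)).trans (map_zero ψ)

/-- A map of right modules into a character module is a character of the tensor product. -/
noncomputable def BalancedTensor.character {N M : Type w} [AddCommGroup N] [Module Sᵐᵒᵖ N]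
    [AddCommGroup M] [Module S M] (φ : N →ₗ[Sᵐᵒᵖ] CharacterModule M) :
    BalancedTensor S N M →+ AddCircle (1 : ℚ) :=
  QuotientAddGroup.lift _ (TensorProduct.liftAddHom
    (φ.toAddMonoidHom : N →+ (M →+ AddCircle (1 : ℚ))) fun r n m =>
      (congrArg (fun θ : CharacterModule M => θ m) (map_zsmul φ.toAddMonoidHom r n)).trans
        (map_zsmul (φ n : M →+ AddCircle (1 : ℚ)) r m).symm) <| by
    refine (AddSubgroup.closure_le _).mpr ?_
    rintro _ ⟨n, s, m, rfl⟩
    rw [SetLike.mem_coe, AddMonoidHom.mem_ker, map_sub, sub_eq_zero]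
    exact congrArg (fun θ : CharacterModule M => θ m) (φ.map_smul (MulOpposite.op s) n)

/-- A character of the tensor product as a map of right modules into a character module. -/
noncomputable def BalancedTensor.ofCharacter {N M : Type w} [AddCommGroup N] [Module Sᵐᵒᵖ N]
    [AddCommGroup M] [Module S M] (χ : BalancedTensor S N M →+ AddCircle (1 : ℚ)) :
    N →ₗ[Sᵐᵒᵖ] CharacterModule M where
  toFun n := AddMonoidHom.mk' (fun m => χ (QuotientAddGroup.mk (n ⊗ₜ[ℤ] m))) fun a b => by
    rw [TensorProduct.tmul_add, QuotientAddGroup.mk_add, map_add]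
  map_add' a b := by
    ext m
    change χ _ = χ _ + χ _
    rw [TensorProduct.add_tmul, QuotientAddGroup.mk_add, map_add]
  map_smul' s n := by
    ext m
    refine congrArg χ ((QuotientAddGroup.eq_iff_sub_mem).mpr ?_)
    exact AddSubgroup.subset_closure ⟨n, s.unop, m, rfl⟩

/-- A left module is flat if and only if its character module is injective. -/
theorem isFlatModule_iff_injective (M : Type w) [AddCommGroup M] [Module S M] :
    IsFlatModule S M ↔ Module.Injective Sᵐᵒᵖ (CharacterModule M) := by
  constructor
  -- Both directions use the adjunction between characters of `N ⊗ M` and maps from `N` to the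
  -- character module of `M`. Here a character extends along the injective map `f ⊗ id`, as `ℚ/ℤ` is
  -- injective.
  · refine fun hM => ⟨fun X Y _ _ _ _ f hf φ => ?_⟩
    obtain ⟨χ, hχ⟩ := CharacterModule.dual_surjective_of_injective (R := ℤ)
      (BalancedTensor.map S M f).toIntLinearMap (hM X Y f hf) (BalancedTensor.character φ)
    refine ⟨BalancedTensor.ofCharacter χ, fun x => ?_⟩
    ext m
    exact congrArg (fun ψ : CharacterModule (BalancedTensor S X M) =>
      ψ (QuotientAddGroup.mk (x ⊗ₜ[ℤ] m))) hχ
  · intro hM X Y _ _ _ _ f hf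
    refine (injective_iff_map_eq_zero _).mpr fun z hz => ?_
    by_contra hz0
    -- A character that detects a kernel element `z` factors through `f ⊗ id`, hence vanishes at
    -- `z`.
    obtain ⟨χ, hχ⟩ := CharacterModule.exists_character_apply_ne_zero_of_ne_zero hz0
    obtain ⟨ψ, hψ⟩ := hM.out f hf (BalancedTensor.ofCharacter χ)
    have key : ∀ t : X ⊗[ℤ] M, BalancedTensor.character ψ
        (BalancedTensor.map S M f (QuotientAddGroup.mk t)) = χ (QuotientAddGroup.mk t) := by
      intro t
      induction t with
      | zero => rw [QuotientAddGroup.mk_zero, map_zero, map_zero, map_zero]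
      | add a b ha hb => rw [QuotientAddGroup.mk_add, map_add, map_add, map_add, ha, hb]
      | tmul x m => exact congrArg (fun θ : CharacterModule M => θ m) (hψ x)
    obtain ⟨t, rfl⟩ := QuotientAddGroup.mk_surjective z
    refine hχ ?_
    rw [← key, hz, map_zero]

end Character

/-! ### Injective modules and restriction of scalars -/

/-- Restriction along a ring homomorphism `R → S` preserves injective modules if `S` is projective
as a right `R`-module; `e` and `c` form a dual basis. -/
theorem Module.Injective.restrict {R S : Type u} [Ring R] [Ring S] (f : R →+* S) {ι : Type v}
    (e : ι → S) (c : S →+ (ι →₀ R)) (hec : ∀ s, s = (c s).sum fun t r => e t * f r)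
    (hc : ∀ s r t, c (s * f r) t = c s t * r) {I : Type u} [AddCommGroup I] [Module R I]
    [Module S I] (hI : ∀ (r : R) (x : I), r • x = f r • x) (h : Module.Injective S I) :
    Module.Injective R I := by
  classical
  refine Module.Baer.injective fun J φ => ?_
  have hcmul : ∀ (s x : S) (u : ι), c (s * x) u = (c x).sum fun t r => c (s * e t) u * r := by
    intro s x u
    conv_lhs => rw [hec x]
    rw [Finsupp.sum, Finset.mul_sum, map_sum, Finsupp.finsetSum_apply, Finsupp.sum]
    refine Finset.sum_congr rfl fun t _ => ?_
    rw [← mul_assoc, hc]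
  -- This is the left ideal `S * f(J)`, described by coordinates. It plays the role of `S ⊗_R J`, so
  -- `φ` extends to it `S`-linearly by acting on coordinates.
  let L : Submodule S S :=
    { carrier := {x | ∀ t, c x t ∈ J}
      add_mem' := fun {a b} ha hb t => by
        rw [map_add]
        exact J.add_mem (ha t) (hb t)
      zero_mem' := fun t => by simp
      smul_mem' := fun s x hx u => by
        rw [smul_eq_mul, hcmul]
        exact Submodule.sum_mem _ fun t _ => J.mul_mem_left _ (hx t) }
  let Φ₀ : L →+ I := AddMonoidHom.mk'
    (fun x => ∑ᶠ t, e t • φ ⟨c x t, x.2 t⟩) fun x y => by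
      have hfin : ∀ z : L, (Function.support fun t => e t • φ ⟨c z t, z.2 t⟩).Finite := fun z => by
        refine (c z).hasFiniteSupport.subset fun t ht h0 => ht ?_
        have : (⟨c z t, z.2 t⟩ : J) = 0 := Subtype.ext h0
        simp only [this, map_zero, smul_zero]
      rw [← finsum_add_distrib (hfin x) (hfin y)]
      refine finsum_congr fun t => ?_
      rw [← smul_add, ← map_add]
      congr 2
      exact Subtype.ext (by simp)
  have hΦ : ∀ (x : L) (s : Finset ι), (c x).support ⊆ s →
      Φ₀ x = ∑ t ∈ s, e t • φ ⟨c x t, x.2 t⟩ := by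
    intro x s hs
    refine finsum_eq_sum_of_support_subset _ fun t ht => hs (Finsupp.mem_support_iff.mpr fun h0 => ht ?_)
    have : (⟨c x t, x.2 t⟩ : J) = 0 := Subtype.ext h0
    simp only [this, map_zero, smul_zero]
  have hsum : ∀ (s : Finset ι) (a b : ι → R) (hb : ∀ t, b t ∈ J) (hab : ∑ t ∈ s, a t * b t ∈ J),
      φ ⟨∑ t ∈ s, a t * b t, hab⟩ = ∑ t ∈ s, f (a t) • φ ⟨b t, hb t⟩ := by
    intro s a b hb hab
    simp only [← hI, ← map_smul, ← map_sum]
    congr 1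
    exact Subtype.ext (by simp)
  have hes : ∀ (s : S) (U : Finset ι), (c s).support ⊆ U → s = ∑ u ∈ U, e u * f (c s u) := by
    intro s U hU
    conv_lhs => rw [hec s]
    exact Finsupp.sum_of_support_subset _ hU _ fun _ _ => by simp
  let Φ : L →ₗ[S] I :=
    { Φ₀ with
      map_smul' := fun s x => by
        change Φ₀ (s • x) = s • Φ₀ x
        set T := (c x).support
        set U := (c ((s • x : L) : S)).support ∪ T.biUnion fun t => (c (s * e t)).support
        rw [hΦ x T subset_rfl, hΦ (s • x) U Finset.subset_union_left, Finset.smul_sum]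
        have h₁ : ∀ u, φ ⟨c ((s • x : L) : S) u, (s • x).2 u⟩
            = ∑ t ∈ T, f (c (s * e t) u) • φ ⟨c x t, x.2 t⟩ := by
          intro u
          have hcu : c ((s • x : L) : S) u = ∑ t ∈ T, c (s * e t) u * c x t := hcmul s x u
          rw [← hsum T _ _ x.2 (hcu ▸ (s • x).2 u)]
          congr 1
          exact Subtype.ext hcu
        simp only [h₁, Finset.smul_sum]
        rw [Finset.sum_comm]
        refine Finset.sum_congr rfl fun t ht => ?_
        have h₂ := hes (s * e t) U ((Finset.subset_biUnion_of_mem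
          (fun t => (c (s * e t)).support) ht).trans Finset.subset_union_right)
        rw [smul_smul]
        conv_rhs => rw [h₂, Finset.sum_smul]
        simp only [smul_smul] }
  obtain ⟨Ψ, hΨ⟩ := h.out L.subtype L.injective_subtype Φ
  refine ⟨LinearMap.toSpanSingleton R I (Ψ 1), fun x hx => ?_⟩
  have hcx : ∀ t, c (f x) t = c 1 t * x := fun t => by simpa using hc 1 x t
  have hxL : f x ∈ L := fun t => by
    rw [hcx]
    exact J.mul_mem_left _ hx
  have h₁ := hΨ ⟨f x, hxL⟩
  have h₂ : Ψ (f x) = x • Ψ 1 := by rw [hI, ← map_smul, smul_eq_mul, mul_one]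
  rw [LinearMap.toSpanSingleton_apply, ← h₂]
  refine h₁.trans ?_
  change Φ₀ ⟨f x, hxL⟩ = _
  rw [hΦ ⟨f x, hxL⟩ (c 1).support]
  · have h₃ : ∀ t, φ ⟨c (f x) t, hxL t⟩ = f (c 1 t) • φ ⟨x, hx⟩ := by
      intro t
      rw [← hI, ← map_smul]
      congr 1
      exact Subtype.ext (hcx t)
    simp only [h₃, smul_smul, ← Finset.sum_smul]
    rw [← hes 1 _ subset_rfl, one_smul]
  · intro t ht
    rw [Finsupp.mem_support_iff] at ht ⊢
    intro h0
    exact ht (by simp [hcx, h0])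

/-- A module over `S` that is injective over `R` is injective if one can average over `S / R`:
the elements `a i`, `b i` satisfy `∑ s a i ⊗ b i = ∑ a i ⊗ b i s` for generators `s` of `S`,
and the inverse `d` of `∑ a i b i` is central. -/
theorem Module.Injective.of_restrict {R S : Type u} [Ring R] [Ring S] (f : R →+* S) {ι : Type v}
    [Fintype ι] (a b : ι → S) (d : S) (hd : ∀ s, s * d = d * s) (hab : (∑ i, a i * b i) * d = 1)
    (A : Set S) (hA : AddSubgroup.closure A = ⊤)
    (hs : ∀ s ∈ A, ∃ (σ : Equiv.Perm ι) (r : ι → R),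
      (∀ i, s * a i = a (σ i) * f (r i)) ∧ ∀ i, b (σ i) * s = f (r i) * b i)
    {I : Type u} [AddCommGroup I] [Module R I] [Module S I]
    (hI : ∀ (r : R) (x : I), r • x = f r • x) (h : Module.Injective R I) :
    Module.Injective S I := by
  refine ⟨fun X Y _ _ _ _ g hg φ => ?_⟩
  let _ : Module R X := Module.compHom X f
  let _ : Module R Y := Module.compHom Y f
  obtain ⟨ψ, hψ⟩ := h.out (X := X) (Y := Y)
    { toFun := g, map_add' := g.map_add, map_smul' := fun r x => g.map_smul (f r) x } hg
    { toFun := φ, map_add' := φ.map_add,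
      map_smul' := fun r x => (φ.map_smul (f r) x).trans (hI r _).symm }
  have hψf : ∀ (r : R) (y : Y), ψ (f r • y) = f r • ψ y := fun r y =>
    (ψ.map_smul r y).trans (hI r _)
  -- Maschke's averaging of the `R`-linear extension `ψ`; a generator of `S` merely permutes the
  -- summands.
  let θ : Y →+ I := AddMonoidHom.mk' (fun y => ∑ i, a i • ψ (b i • d • y)) fun x y => by
    simp only [smul_add, map_add, Finset.sum_add_distrib]
  have hθ : ∀ (s : S) (y : Y), θ (s • y) = s • θ y := by
    intro s y
    have hmem : s ∈ AddSubgroup.closure A := hA ▸ AddSubgroup.mem_top s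
    induction hmem using AddSubgroup.closure_induction with
    | mem s hsA =>
      obtain ⟨σ, r, h₁, h₂⟩ := hs s hsA
      change ∑ i, a i • ψ (b i • d • s • y) = s • ∑ i, a i • ψ (b i • d • y)
      rw [← Equiv.sum_comp σ, Finset.smul_sum]
      refine Finset.sum_congr rfl fun i _ => ?_
      rw [smul_smul d s, ← hd, ← smul_smul s d, smul_smul (b (σ i)), h₂, ← smul_smul (f (r i)),
        hψf, smul_smul (a (σ i)), ← h₁, mul_smul]
    | zero => rw [zero_smul, zero_smul, map_zero]
    | add x y _ _ hx hy => rw [add_smul, add_smul, map_add, hx, hy]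
    | neg x _ hx => rw [neg_smul, neg_smul, map_neg, hx]
  refine ⟨{ θ with map_smul' := hθ }, fun x => ?_⟩
  change ∑ i, a i • ψ (b i • d • g x) = φ x
  have h₁ : ∀ i, ψ (b i • d • g x) = b i • d • φ x := fun i => by
    rw [← map_smul, ← map_smul, ← map_smul φ, ← map_smul φ]
    exact hψ _
  simp only [h₁]
  simp only [smul_smul, ← Finset.sum_smul, ← mul_assoc, ← Finset.sum_mul]
  rw [hab, one_smul]

/-! ### Group rings of subgroups -/

section GroupRing

/-- Right coset representatives for an injective homomorphism of groups. -/
theorem exists_right_transversal {N G : Type u} [Group N] [Group G] (i : N →* G)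
    (hi : Function.Injective i) :
    ∃ (e : Quotient (QuotientGroup.rightRel i.range) → G)
      (t : G → Quotient (QuotientGroup.rightRel i.range)) (n : G → N),
      (∀ g, g = i (n g) * e (t g)) ∧ (∀ m g, t (i m * g) = t g) ∧
      (∀ m g, n (i m * g) = m * n g) ∧ (∀ s, t (e s) = s) ∧
      ∀ g g' h, t g = t g' → t (g * h) = t (g' * h) := by
  have hex : ∀ g : G, ∃ m : N, i m = g * (Quotient.out
      (Quotient.mk (QuotientGroup.rightRel i.range) g))⁻¹ := fun g => by
    have := Quotient.exact (Quotient.out_eq (Quotient.mk (QuotientGroup.rightRel i.range) g))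
    exact QuotientGroup.rightRel_apply.mp this
  choose n hn using hex
  have ht : ∀ m g, Quotient.mk (QuotientGroup.rightRel i.range) (i m * g) = Quotient.mk _ g := by
    intro m g
    refine Quotient.sound (QuotientGroup.rightRel_apply.mpr ?_)
    exact ⟨m⁻¹, by simp⟩
  refine ⟨Quotient.out, Quotient.mk _, n, fun g => ?_, ht, fun m g => hi ?_, Quotient.out_eq, ?_⟩
  · rw [hn, inv_mul_cancel_right]
  · rw [hn, map_mul, hn, ht, mul_assoc]
  · intro g g' h hgg'
    have := QuotientGroup.rightRel_apply.mp (Quotient.exact hgg')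
    refine Quotient.sound (QuotientGroup.rightRel_apply.mpr ?_)
    simpa [mul_assoc] using this

variable {N G : Type u} [Group N] [Group G]

/-- The ring homomorphism between the opposites of the rational group rings that is induced by a
group homomorphism. -/
noncomputable abbrev opGroupRingHom (i : N →* G) :
    (MonoidAlgebra ℚ N)ᵐᵒᵖ →+* (MonoidAlgebra ℚ G)ᵐᵒᵖ :=
  (MonoidAlgebra.mapDomainRingHom ℚ i).op

theorem opGroupRing_closure :
    AddSubgroup.closure {s : (MonoidAlgebra ℚ G)ᵐᵒᵖ |
      ∃ (g : G) (q : ℚ), s = MulOpposite.op (MonoidAlgebra.single g q)} = ⊤ := by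
  refine eq_top_iff.mpr fun s _ => ?_
  obtain ⟨x, rfl⟩ := MulOpposite.op_surjective s
  induction x using MonoidAlgebra.induction_linear with
  | zero => exact zero_mem _
  | add x y hx hy => exact add_mem (hx trivial) (hy trivial)
  | single g q => exact AddSubgroup.subset_closure ⟨g, q, rfl⟩

/-- `ℚ[G]` is free as a left `ℚ[N]`-module on right coset representatives, hence its opposite is
free as a right module. The map `c₀` gives the coordinates. -/
theorem Module.Injective.restrict_groupRing {i : N →* G} (hi : Function.Injective i) {I : Type u}
    [AddCommGroup I] [Module (MonoidAlgebra ℚ N)ᵐᵒᵖ I] [Module (MonoidAlgebra ℚ G)ᵐᵒᵖ I]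
    (hI : ∀ (r : (MonoidAlgebra ℚ N)ᵐᵒᵖ) (x : I), r • x = opGroupRingHom i r • x)
    (h : Module.Injective (MonoidAlgebra ℚ G)ᵐᵒᵖ I) :
    Module.Injective (MonoidAlgebra ℚ N)ᵐᵒᵖ I := by
  classical
  obtain ⟨e, t, n, hg, ht, hn, -, -⟩ := exists_right_transversal i hi
  let c₀ : MonoidAlgebra ℚ G →+ (Quotient (QuotientGroup.rightRel i.range) →₀
      (MonoidAlgebra ℚ N)ᵐᵒᵖ) :=
    (Finsupp.liftAddHom fun g => (Finsupp.singleAddHom (t g)).comp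
      ((MulOpposite.opAddEquiv.toAddMonoidHom).comp
        (MonoidAlgebra.singleAddHom (n g)))).comp MonoidAlgebra.coeffAddEquiv.toAddMonoidHom
  have hc₀ : ∀ g q, c₀ (MonoidAlgebra.single g q)
      = Finsupp.single (t g) (MulOpposite.op (MonoidAlgebra.single (n g) q)) := by
    intro g q
    simp [c₀]
  refine Module.Injective.restrict (opGroupRingHom i)
    (fun s => MulOpposite.op (MonoidAlgebra.single (e s) 1))
    (c₀.comp MulOpposite.opAddEquiv.symm.toAddMonoidHom) ?_ ?_ hI h
  · intro s
    obtain ⟨x, rfl⟩ := MulOpposite.op_surjective s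
    change _ = (c₀ x).sum _
    induction x using MonoidAlgebra.induction_linear with
    | zero => simp
    | add x y hx hy =>
      rw [map_add, Finsupp.sum_add_index', ← hx, ← hy, MulOpposite.op_add]
      · simp
      · intro s a b
        rw [map_add, mul_add]
    | single g q =>
      rw [hc₀, Finsupp.sum_single_index (by simp)]
      conv_lhs => rw [hg g]
      simp [← MulOpposite.op_mul]
  · intro s r k
    obtain ⟨x, rfl⟩ := MulOpposite.op_surjective s
    obtain ⟨y, rfl⟩ := MulOpposite.op_surjective r
    change c₀ (MonoidAlgebra.mapDomainRingHom ℚ i y * x) k = c₀ x k * _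
    induction x using MonoidAlgebra.induction_linear with
    | zero => simp
    | add x y hx hy => rw [mul_add, map_add, map_add, Finsupp.add_apply, Finsupp.add_apply, hx, hy,
        add_mul]
    | single g q =>
      induction y using MonoidAlgebra.induction_linear with
      | zero => simp
      | add x y hx hy => rw [map_add, add_mul, map_add, Finsupp.add_apply, hx, hy,
          MulOpposite.op_add, mul_add]
      | single m q' =>
        simp only [MonoidAlgebra.mapDomainRingHom_apply, MonoidAlgebra.mapDomain_single,
          MonoidAlgebra.single_mul_single, hc₀, ht, hn, Finsupp.single_apply]
        split_ifs
        · simp [← MulOpposite.op_mul]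
        · simp

/-- Average over right coset representatives and their inverses. The coefficients are rational so
that the index can be inverted. -/
theorem Module.Injective.of_restrict_groupRing {i : N →* G} (hi : Function.Injective i)
    [i.range.FiniteIndex] {I : Type u}
    [AddCommGroup I] [Module (MonoidAlgebra ℚ N)ᵐᵒᵖ I] [Module (MonoidAlgebra ℚ G)ᵐᵒᵖ I]
    (hI : ∀ (r : (MonoidAlgebra ℚ N)ᵐᵒᵖ) (x : I), r • x = opGroupRingHom i r • x)
    (h : Module.Injective (MonoidAlgebra ℚ N)ᵐᵒᵖ I) :
    Module.Injective (MonoidAlgebra ℚ G)ᵐᵒᵖ I := by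
  classical
  obtain ⟨e, t, n, hg, ht, hn, hte, htr⟩ := exists_right_transversal i hi
  have hfin : Finite (Quotient (QuotientGroup.rightRel i.range)) :=
    Finite.of_equiv _ (QuotientGroup.quotientRightRelEquivQuotientLeftRel i.range).symm
  have := Fintype.ofFinite (Quotient (QuotientGroup.rightRel i.range))
  have hne : (Fintype.card (Quotient (QuotientGroup.rightRel i.range)) : ℚ) ≠ 0 := by
    have : Nonempty (Quotient (QuotientGroup.rightRel i.range)) := ⟨t 1⟩
    exact_mod_cast Fintype.card_ne_zero
  refine Module.Injective.of_restrict (opGroupRingHom i)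
    (fun s => MulOpposite.op (MonoidAlgebra.single (e s) 1))
    (fun s => MulOpposite.op (MonoidAlgebra.single (e s)⁻¹ 1))
    (MulOpposite.op (MonoidAlgebra.single 1
      (Fintype.card (Quotient (QuotientGroup.rightRel i.range)) : ℚ)⁻¹)) ?_ ?_ _
    opGroupRing_closure ?_ hI h
  · intro s
    rw [← MulOpposite.op_unop s, ← MulOpposite.op_mul, ← MulOpposite.op_mul,
      MonoidAlgebra.single_one_comm]
  · simp only [← MulOpposite.op_mul, MonoidAlgebra.single_mul_single, inv_mul_cancel, mul_one,
      Finset.sum_const, Finset.card_univ, nsmul_eq_mul]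
    rw [← MonoidAlgebra.one_def, MulOpposite.op_one, mul_one, ← MulOpposite.op_natCast,
      ← MulOpposite.op_mul, MonoidAlgebra.natCast_def, MonoidAlgebra.single_mul_single, mul_one,
      inv_mul_cancel₀ hne]
    rfl
  · rintro _ ⟨g, q, rfl⟩
    have hinv : ∀ (g : G) s, t (e (t (e s * g)) * g⁻¹) = s := fun g s => by
      rw [htr _ (e s * g) _ (hte _), mul_inv_cancel_right, hte]
    -- Right multiplication by `g` permutes the right cosets, with cocycle `n (e s * g)` in `N`.
    refine ⟨⟨fun s => t (e s * g), fun s => t (e s * g⁻¹), hinv g,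
      fun s => by simpa using hinv g⁻¹ s⟩,
      fun s => MulOpposite.op (MonoidAlgebra.single (n (e s * g)) q), fun s => ?_, fun s => ?_⟩
    · change MulOpposite.op _ = MulOpposite.op (MonoidAlgebra.mapDomainRingHom ℚ i _ * _)
      simp only [MulOpposite.unop_op, MonoidAlgebra.mapDomainRingHom_apply,
        MonoidAlgebra.mapDomain_single, MonoidAlgebra.single_mul_single, Equiv.coe_fn_mk, ← hg]
      simp
    · change MulOpposite.op _ = MulOpposite.op (_ * MonoidAlgebra.mapDomainRingHom ℚ i _)
      have : g * (e (t (e s * g)))⁻¹ = (e s)⁻¹ * i (n (e s * g)) := by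
        rw [eq_inv_mul_iff_mul_eq, ← mul_assoc, mul_inv_eq_iff_eq_mul]
        exact hg _
      simp only [MulOpposite.unop_op, MonoidAlgebra.mapDomainRingHom_apply,
        MonoidAlgebra.mapDomain_single, MonoidAlgebra.single_mul_single, Equiv.coe_fn_mk, this]
      simp

end GroupRing

/-! ### Flat resolutions and injective dimension -/

section Resolution

variable {R S : Type u} [Ring R] [Ring S]

/-- The character module of a left `S`-module, as a right `R`-module. -/
noncomputable abbrev restrictedDual (f : R →+* S) (M : Type u) [AddCommGroup M] [Module S M] :
    ModuleCat.{u} Rᵐᵒᵖ :=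
  (ModuleCat.restrictScalars f.op).obj (ModuleCat.of Sᵐᵒᵖ (CharacterModule M))

theorem injective_restrictedDual_iff (f : R →+* S) (M : Type u) [AddCommGroup M] [Module S M] :
    CategoryTheory.Injective (restrictedDual f M) ↔
      Module.Injective Rᵐᵒᵖ (restrictedDual f M) :=
  (Module.injective_iff_injective_object Rᵐᵒᵖ (restrictedDual f M)).symm

/-- Dimension shifting along an extension `0 → K → F → M → 0`. -/
theorem hasInjectiveDimensionLE_restrictedDual_iff (f : R →+* S) {K F M : Type u}
    [AddCommGroup K] [Module S K] [AddCommGroup F] [Module S F] [AddCommGroup M] [Module S M]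
    {i : K →ₗ[S] F} {p : F →ₗ[S] M} (hi : Function.Injective i) (hip : Function.Exact i p)
    (hp : Function.Surjective p) (hF : CategoryTheory.Injective (restrictedDual f F)) (n : ℕ) :
    CategoryTheory.HasInjectiveDimensionLE (restrictedDual f K) n ↔
      CategoryTheory.HasInjectiveDimensionLE (restrictedDual f M) (n + 1) := by
  have hex := CharacterModule.precomp_exact hip hp
  -- Dualizing gives `0 → M* → F* → K* → 0` with injective middle term.
  let T : CategoryTheory.ShortComplex (ModuleCat.{u} Rᵐᵒᵖ) :=
    { f := (ModuleCat.restrictScalars f.op).map (ModuleCat.ofHom (CharacterModule.precomp p))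
      g := (ModuleCat.restrictScalars f.op).map (ModuleCat.ofHom (CharacterModule.precomp i))
      zero := by
        ext χ
        exact hex.apply_apply_eq_zero χ }
  have hT : T.ShortExact := ModuleCat.shortComplex_shortExact T hex
    (CharacterModule.precomp_injective hp) (CharacterModule.precomp_surjective hi)
  exact hT.hasInjectiveDimensionLT_X₃_iff n hF

/-- Additively isomorphic modules with the same action of `R` have isomorphic restricted duals. -/
noncomputable def restrictedDualIso {S' : Type u} [Ring S'] (f : R →+* S) (f' : R →+* S')
    {M M' : Type u} [AddCommGroup M] [Module S M] [AddCommGroup M'] [Module S' M'] (e : M ≃+ M')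
    (he : ∀ r m, e (f r • m) = f' r • e m) : restrictedDual f M ≅ restrictedDual f' M' :=
  LinearEquiv.toModuleIso (R := Rᵐᵒᵖ) (X₁ := restrictedDual f M) (X₂ := restrictedDual f' M')
    (g₁ := (restrictedDual f M).isAddCommGroup) (g₂ := (restrictedDual f' M').isAddCommGroup)
    (m₁ := (restrictedDual f M).isModule) (m₂ := (restrictedDual f' M').isModule)
    { toFun := fun (χ : M →+ AddCircle (1 : ℚ)) => χ.comp e.symm.toAddMonoidHom
      invFun := fun (χ : M' →+ AddCircle (1 : ℚ)) => χ.comp e.toAddMonoidHom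
      map_add' := fun _ _ => rfl
      left_inv := fun (χ : M →+ AddCircle (1 : ℚ)) =>
        AddMonoidHom.ext fun m => congrArg χ (e.symm_apply_apply m)
      right_inv := fun (χ : M' →+ AddCircle (1 : ℚ)) =>
        AddMonoidHom.ext fun m => congrArg χ (e.apply_symm_apply m)
      map_smul' := fun r (χ : M →+ AddCircle (1 : ℚ)) => by
        have h : ∀ m, f r.unop • e.symm m = e.symm (f' r.unop • m) := fun m => by
          rw [eq_comm, AddEquiv.symm_apply_eq, he, AddEquiv.apply_symm_apply]
        exact AddMonoidHom.ext fun m => congrArg χ (h m) }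

theorem IsFlatModule.congr {M M' : Type u} [AddCommGroup M] [Module S M] [AddCommGroup M']
    [Module S M'] (e : M ≃ₗ[S] M') (h : IsFlatModule S M) : IsFlatModule S M' := by
  rw [isFlatModule_iff_injective] at h ⊢
  have : CharacterModule M ≃ₗ[Sᵐᵒᵖ] CharacterModule M' :=
    LinearEquiv.ofBijective (CharacterModule.precomp e.symm.toLinearMap)
      ⟨CharacterModule.precomp_injective e.symm.surjective,
        CharacterModule.precomp_surjective e.symm.injective⟩
  exact Module.Baer.injective (Module.Baer.of_equiv this (Module.Baer.of_injective h))

theorem HasFlatResolution.congr {M : Type v} {M' : Type w} [AddCommGroup M] [Module S M]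
    [AddCommGroup M'] [Module S M'] (e : M ≃ₗ[S] M') {n : ℕ} (h : HasFlatResolution S M n) :
    HasFlatResolution S M' n := by
  obtain ⟨F, d, ε, hF, hn, hε, h0, hd⟩ := h
  refine ⟨F, d, e.toLinearMap ∘ₗ ε, hF, hn, e.surjective.comp hε, fun x => ?_, hd⟩
  rw [← h0 x]
  simp

theorem isFlatModule_of_subsingleton (M : Type u) [AddCommGroup M] [Module S M]
    [Subsingleton M] : IsFlatModule S M := by
  rw [isFlatModule_iff_injective]
  have : Subsingleton (CharacterModule M) := ⟨fun χ ψ => by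
    ext m
    rw [Subsingleton.elim m 0, map_zero, map_zero]⟩
  exact ⟨fun X Y _ _ _ _ g hg φ => ⟨0, fun x => Subsingleton.elim _ _⟩⟩

theorem hasFlatResolution_zero_iff (M : Type u) [AddCommGroup M] [Module S M] :
    HasFlatResolution S M 0 ↔ IsFlatModule S M := by
  constructor
  · rintro ⟨F, d, ε, hF, hn, hε, h0, hd⟩
    have := hn 1 one_pos
    refine (hF 0).congr (LinearEquiv.ofBijective ε ⟨?_, hε⟩)
    refine (injective_iff_map_eq_zero _).mpr fun x hx => ?_
    obtain ⟨y, rfl⟩ := (h0 x).mp hx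
    rw [Subsingleton.elim y 0, map_zero]
  · intro hM
    refine ⟨fun i => Nat.casesOn i (ModuleCat.of S M) fun _ => ModuleCat.of S PUnit, fun i => 0,
      LinearMap.id, fun i => ?_, fun i hi => ?_, fun x => ⟨x, rfl⟩, fun x => ?_, fun i x => ?_⟩
    · cases i with
      | zero => exact hM
      | succ i => exact isFlatModule_of_subsingleton (S := S) PUnit
    · cases i with
      | zero => exact absurd hi (lt_irrefl 0)
      | succ i => exact inferInstanceAs (Subsingleton PUnit)
    · exact ⟨fun h => ⟨0, h.symm⟩, fun ⟨_, h⟩ => h.symm⟩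
    · exact ⟨fun _ => ⟨0, rfl⟩, fun _ => rfl⟩

/-- Splitting off the first syzygy lets flat resolutions be compared with injective dimension by
induction on length. -/
theorem hasFlatResolution_succ_iff (M : Type u) [AddCommGroup M] [Module S M] (n : ℕ) :
    HasFlatResolution S M (n + 1) ↔ ∃ (F : ModuleCat.{u} S) (p : F →ₗ[S] M),
      IsFlatModule S F ∧ Function.Surjective p ∧ HasFlatResolution S (LinearMap.ker p) n := by
  constructor
  · rintro ⟨F, d, ε, hF, hn, hε, h0, hd⟩
    have hmem : ∀ x, d 0 x ∈ LinearMap.ker ε := fun x => h0.apply_apply_eq_zero x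
    refine ⟨F 0, ε, hF 0, hε, fun i => F (i + 1), fun i => d (i + 1),
      (d 0).codRestrict _ hmem, fun i => hF _, fun i hi => hn _ (Nat.succ_lt_succ hi),
      fun x => ?_, fun x => ?_, fun i => hd _⟩
    · obtain ⟨y, hy⟩ := (h0 x).mp x.2
      exact ⟨y, Subtype.ext hy⟩
    · rw [← hd 0 x]
      exact Subtype.ext_iff
  · rintro ⟨P, p, hP, hp, F, d, ε, hF, hn, hε, h0, hd⟩
    refine ⟨fun i => Nat.casesOn i P F,
      fun i => match i with
        | 0 => (LinearMap.ker p).subtype ∘ₗ ε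
        | i + 1 => d i, p, fun i => ?_, fun i hi => ?_, hp, fun x => ?_, fun i => ?_⟩
    · cases i with
      | zero => exact hP
      | succ i => exact hF i
    · cases i with
      | zero => exact absurd hi (Nat.not_lt_zero _)
      | succ i => exact hn i (Nat.lt_of_succ_lt_succ hi)
    · constructor
      · intro hx
        obtain ⟨y, hy⟩ := hε ⟨x, hx⟩
        exact ⟨y, congrArg Subtype.val hy⟩
      · rintro ⟨y, rfl⟩
        exact (ε y).2
    · cases i with
      | zero =>
        intro x
        rw [← h0 x]
        exact (Subtype.ext_iff : ε x = 0 ↔ (ε x : P) = ((0 : LinearMap.ker p) : P)).symm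
      | succ i => exact hd i

/-- A flat resolution bounds the injective dimension of the character module. -/
theorem HasFlatResolution.hasInjectiveDimensionLE {f : R →+* S}
    (hf : ∀ (F : Type u) [AddCommGroup F] [Module S F], IsFlatModule S F →
      CategoryTheory.Injective (restrictedDual f F)) {n : ℕ} {M : Type u} [AddCommGroup M]
    [Module S M] (h : HasFlatResolution S M n) :
    CategoryTheory.HasInjectiveDimensionLE (restrictedDual f M) n := by
  induction n generalizing M with
  | zero =>
    exact CategoryTheory.injective_iff_hasInjectiveDimensionLT_one.mp
      (hf M ((hasFlatResolution_zero_iff M).mp h))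
  | succ n ih =>
    obtain ⟨F, p, hF, hp, hK⟩ := (hasFlatResolution_succ_iff M n).mp h
    exact (hasInjectiveDimensionLE_restrictedDual_iff f (Submodule.injective_subtype _)
      (LinearMap.exact_subtype_ker_map p) hp (hf F hF) n).mp (ih hK)

/-- A map from `A` to the character module of `X →₀ S` is a family, indexed by `X`, of characters of
`A`; each extends to `B`. -/
theorem isFlatModule_finsupp (X : Type u) : IsFlatModule S (X →₀ S) := by
  rw [isFlatModule_iff_injective]
  refine ⟨fun A B _ _ _ _ g hg φ => ?_⟩
  have hex : ∀ x : X, ∃ χ : B →+ AddCircle (1 : ℚ), ∀ a, χ (g a) = φ a (Finsupp.single x 1) := by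
    intro x
    let θ : CharacterModule A := AddMonoidHom.mk' (fun a => φ a (Finsupp.single x 1)) fun a b => by
      rw [map_add]
      rfl
    obtain ⟨χ, hχ⟩ := CharacterModule.dual_surjective_of_injective (R := ℤ)
      g.toAddMonoidHom.toIntLinearMap hg θ
    exact ⟨χ, fun a => congrArg (fun ψ : CharacterModule A => ψ a) hχ⟩
  choose χ hχ using hex
  let D : B → ((X →₀ S) →+ AddCircle (1 : ℚ)) := fun b => Finsupp.liftAddHom fun x =>
    AddMonoidHom.mk' (fun s : S => χ x (MulOpposite.op s • b)) fun s t => by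
      rw [MulOpposite.op_add, add_smul, map_add]
  have hD : ∀ b x t, D b (Finsupp.single x t) = χ x (MulOpposite.op t • b) := fun b x t => by
    simp [D]
  refine ⟨⟨⟨D, fun b b' => ?_⟩, fun s b => ?_⟩, fun a => ?_⟩
  · refine Finsupp.addHom_ext (f := D (b + b')) (g := D b + D b') fun x t => ?_
    rw [AddMonoidHom.add_apply, hD, hD, hD, smul_add, map_add]
  · refine Finsupp.addHom_ext (f := D (s • b))
      (g := (D b).comp (DistribSMul.toAddMonoidHom _ s.unop)) fun x t => ?_
    change _ = D b (s.unop • Finsupp.single x t)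
    rw [Finsupp.smul_single, hD, hD, smul_smul]
    rfl
  · refine Finsupp.addHom_ext (f := D (g a)) (g := (φ a : (X →₀ S) →+ AddCircle (1 : ℚ)))
      fun x t => ?_
    rw [hD, ← map_smul, hχ, map_smul]
    change φ a (t • Finsupp.single x 1) = _
    rw [Finsupp.smul_single, smul_eq_mul, mul_one]
    rfl

/-- If flatness over `S` is detected by the restricted dual, then its injective dimension bounds
the length of a flat resolution. -/
theorem hasFlatResolution_of_hasInjectiveDimensionLE {f : R →+* S}
    (hf : ∀ (F : Type u) [AddCommGroup F] [Module S F], IsFlatModule S F ↔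
      CategoryTheory.Injective (restrictedDual f F)) {n : ℕ} {M : Type u} [AddCommGroup M]
    [Module S M] (h : CategoryTheory.HasInjectiveDimensionLE (restrictedDual f M) n) :
    HasFlatResolution S M n := by
  induction n generalizing M with
  | zero =>
    exact (hasFlatResolution_zero_iff M).mpr ((hf M).mpr
      (CategoryTheory.injective_iff_hasInjectiveDimensionLT_one.mpr h))
  | succ n ih =>
    -- Cover `M` by the free module on its own elements and shift dimension.
    have hp : Function.Surjective (Finsupp.linearCombination S (id : M → M)) :=
      Finsupp.linearCombination_id_surjective S M
    refine (hasFlatResolution_succ_iff M n).mpr ⟨ModuleCat.of S (M →₀ S),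
      Finsupp.linearCombination S (id : M → M), isFlatModule_finsupp M, hp, ih ?_⟩
    exact (hasInjectiveDimensionLE_restrictedDual_iff f (Submodule.injective_subtype _)
      (LinearMap.exact_subtype_ker_map _) hp ((hf _).mp (isFlatModule_finsupp M)) n).mpr h

end Resolution

/-! ### Homological dimension of commensurable groups -/

section HomologicalDimension

variable {N G : Type u} [Group N] [Group G]

theorem IsFlatModule.injective_restrictedDual {i : N →* G} (hi : Function.Injective i) {F : Type u}
    [AddCommGroup F] [Module (MonoidAlgebra ℚ G) F] (hF : IsFlatModule (MonoidAlgebra ℚ G) F) :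
    CategoryTheory.Injective (restrictedDual (MonoidAlgebra.mapDomainRingHom ℚ i) F) := by
  rw [injective_restrictedDual_iff]
  let _ : Module (MonoidAlgebra ℚ G)ᵐᵒᵖ
      (restrictedDual (MonoidAlgebra.mapDomainRingHom ℚ i) F) :=
    CharacterModule.rightModule (MonoidAlgebra ℚ G) F
  exact Module.Injective.restrict_groupRing
    (I := restrictedDual (MonoidAlgebra.mapDomainRingHom ℚ i) F) hi (fun _ _ => rfl)
    ((isFlatModule_iff_injective F).mp hF)

theorem isFlatModule_iff_injective_restrictedDual {i : N →* G} (hi : Function.Injective i)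
    [i.range.FiniteIndex] (F : Type u) [AddCommGroup F] [Module (MonoidAlgebra ℚ G) F] :
    IsFlatModule (MonoidAlgebra ℚ G) F ↔
      CategoryTheory.Injective (restrictedDual (MonoidAlgebra.mapDomainRingHom ℚ i) F) := by
  refine ⟨fun hF => hF.injective_restrictedDual hi, fun h => ?_⟩
  rw [injective_restrictedDual_iff] at h
  rw [isFlatModule_iff_injective]
  let _ : Module (MonoidAlgebra ℚ G)ᵐᵒᵖ
      (restrictedDual (MonoidAlgebra.mapDomainRingHom ℚ i) F) :=
    CharacterModule.rightModule (MonoidAlgebra ℚ G) F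
  exact Module.Injective.of_restrict_groupRing
    (I := restrictedDual (MonoidAlgebra.mapDomainRingHom ℚ i) F) hi (fun _ _ => rfl) h

/-- The trivial module of the rational group ring, in the universe of the group. -/
abbrev TrivialModule (G : Type u) [Group G] : Type u :=
  ULift.{u} (Representation.trivial ℚ G ℚ).asModule

theorem single_smul_trivialModule (g : G) (q : ℚ) (x : TrivialModule G) :
    MonoidAlgebra.single g q • x = ULift.up (q • x.down) := by
  refine congrArg ULift.up ?_
  rw [Representation.single_smul]
  rfl

/-- On either side `r` acts through its augmentation. -/
theorem mapDomain_smul_trivialModule {Q : Type u} [Group Q] (i : N →* G) (j : N →* Q)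
    (r : MonoidAlgebra ℚ N) (x : ℚ) :
    ((MonoidAlgebra.mapDomainRingHom ℚ i r • (ULift.up x : TrivialModule G)).down : ℚ)
      = (MonoidAlgebra.mapDomainRingHom ℚ j r • (ULift.up x : TrivialModule Q)).down := by
  induction r using MonoidAlgebra.induction_linear with
  | zero =>
    rw [map_zero, map_zero, zero_smul, zero_smul]
    rfl
  | add a b ha hb =>
    rw [map_add, map_add, add_smul, add_smul]
    exact congrArg₂ (· + ·) ha hb
  | single n q =>
    simp only [MonoidAlgebra.mapDomainRingHom_apply, MonoidAlgebra.mapDomain_single,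
      single_smul_trivialModule]
    rfl

/-- The restricted duals of trivial modules are isomorphic. -/
noncomputable def restrictedDualTrivialIso {Q : Type u} [Group Q] (i : N →* G) (j : N →* Q) :
    restrictedDual (MonoidAlgebra.mapDomainRingHom ℚ i) (TrivialModule G) ≅
      restrictedDual (MonoidAlgebra.mapDomainRingHom ℚ j) (TrivialModule Q) :=
  restrictedDualIso _ _ (AddEquiv.refl (ULift.{u} ℚ)) fun r m =>
    congrArg ULift.up (mapDomain_smul_trivialModule i j r m.down)

theorem homologicalDimension_lt_top_iff (G : Type u) [Group G] :
    homologicalDimension ℚ G < ⊤ ↔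
      ∃ n, HasFlatResolution (MonoidAlgebra ℚ G) (TrivialModule G) n := by
  have : homologicalDimension ℚ G < ⊤ ↔ ∃ n, HasFlatResolution (MonoidAlgebra ℚ G)
      (Representation.trivial ℚ G ℚ).asModule n := by
    simp [homologicalDimension, flatDimension, iInf_lt_iff]
  rw [this]
  exact exists_congr fun n => ⟨fun h => h.congr ULift.moduleEquiv.symm,
    fun h => h.congr ULift.moduleEquiv⟩

/-- Finiteness of the rational homological dimension passes to groups that contain a subgroup
with finite index. -/
theorem homologicalDimension_lt_top_of_finiteIndex {Q : Type u} [Group Q] {i : N →* G}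
    (hi : Function.Injective i) {j : N →* Q} (hj : Function.Injective j) [j.range.FiniteIndex]
    (h : homologicalDimension ℚ G < ⊤) : homologicalDimension ℚ Q < ⊤ := by
  obtain ⟨n, hn⟩ := (homologicalDimension_lt_top_iff G).mp h
  -- The dual of the trivial module, seen over `ℚ[N]`, is the same for `G` and `Q`, so its injective
  -- dimension carries the bound across.
  have h₁ := hn.hasInjectiveDimensionLE fun F _ _ hF => hF.injective_restrictedDual hi
  exact (homologicalDimension_lt_top_iff Q).mpr ⟨n, hasFlatResolution_of_hasInjectiveDimensionLE
    (fun F _ _ => isFlatModule_iff_injective_restrictedDual hj F)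
    (CategoryTheory.hasInjectiveDimensionLT_of_iso (restrictedDualTrivialIso i j) (n + 1))⟩

end HomologicalDimension

/-! ### Asymptotic dimension of commensurable groups -/

section Asdim

open scoped Pointwise in
/-- Word metrics are proper and left-invariant. -/
theorem exists_isProperLeftInvariantMetric (G : Type u) [Group G] [Group.FG G] :
    ∃ m : MetricSpace G, IsProperLeftInvariantMetric G m := by
  classical
  obtain ⟨S, hS, hSfin⟩ := (Group.fg_iff (G := G)).mp inferInstance
  set T : Set G := insert 1 (S ∪ S⁻¹) with hT
  have hTfin : T.Finite := (hSfin.union hSfin.inv).insert 1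
  have hTinv : T⁻¹ = T := by
    rw [hT, Set.inv_insert, inv_one, Set.union_inv, inv_inv, Set.union_comm]
  have hpow : ∀ n : ℕ, (T ^ n).Finite := fun n => by
    induction n with
    | zero => simp
    | succ n ih =>
      rw [pow_succ]
      exact ih.mul hTfin
  have hinv : ∀ {n : ℕ} {x : G}, x ∈ T ^ n → x⁻¹ ∈ T ^ n := fun {n x} hx => by
    rwa [← Set.mem_inv, ← inv_pow, hTinv]
  have hex : ∀ x : G, ∃ n : ℕ, x ∈ T ^ n := fun x => by
    have hx : x ∈ Subgroup.closure S := hS ▸ Subgroup.mem_top x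
    induction hx using Subgroup.closure_induction with
    | mem x hx => exact ⟨1, by rw [pow_one]; exact Or.inr (Or.inl hx)⟩
    | one => exact ⟨0, by simp⟩
    | mul x y _ _ hx hy =>
      obtain ⟨a, ha⟩ := hx
      obtain ⟨b, hb⟩ := hy
      exact ⟨a + b, by rw [pow_add]; exact Set.mul_mem_mul ha hb⟩
    | inv x _ hx => exact hx.imp fun n hn => hinv hn
  let ℓ : G → ℕ := fun x => Nat.find (hex x)
  have hℓ : ∀ x, x ∈ T ^ ℓ x := fun x => Nat.find_spec (hex x)
  have hℓle : ∀ {n : ℕ} {x : G}, x ∈ T ^ n → ℓ x ≤ n := fun hx => Nat.find_min' (hex _) hx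
  have hℓinv : ∀ x, ℓ x⁻¹ = ℓ x := fun x =>
    le_antisymm (hℓle (hinv (hℓ x))) (hℓle (by simpa using hinv (hℓ x⁻¹)))
  refine ⟨{ dist := fun x y => (ℓ (x⁻¹ * y) : ℝ)
            dist_self := fun x => ?_
            dist_comm := fun x y => ?_
            dist_triangle := fun x y z => ?_
            eq_of_dist_eq_zero := fun {x y} h => ?_ }, ⟨fun a x y => ?_, fun x r => ?_⟩⟩
  · rw [inv_mul_cancel, Nat.cast_eq_zero, ← Nat.le_zero]
    exact hℓle (by simp)
  · rw [← hℓinv, mul_inv_rev, inv_inv]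
  · rw [← Nat.cast_add, Nat.cast_le]
    refine hℓle ?_
    rw [pow_add]
    exact ⟨_, hℓ (x⁻¹ * y), _, hℓ (y⁻¹ * z), by simp [mul_assoc]⟩
  · have h0 : ℓ (x⁻¹ * y) = 0 := Nat.cast_eq_zero.mp h
    have := hℓ (x⁻¹ * y)
    rw [h0, pow_zero, Set.mem_one, inv_mul_eq_one] at this
    exact this
  · change ((ℓ ((a * x)⁻¹ * (a * y)) : ℕ) : ℝ) = (ℓ (x⁻¹ * y) : ℕ)
    simp [mul_assoc]
  · obtain ⟨n, hn⟩ := exists_nat_ge r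
    have hfin : (⋃ k ∈ Set.Iic n, (T ^ k)).Finite := (Set.finite_Iic n).biUnion fun k _ => hpow k
    refine ((hfin.image fun t => x * t⁻¹)).subset fun y hy => ⟨y⁻¹ * x, ?_, by simp⟩
    refine Set.mem_biUnion (x := ℓ (y⁻¹ * x)) ?_ (hℓ _)
    have hy' : ((ℓ (y⁻¹ * x) : ℕ) : ℝ) ≤ r := hy
    exact_mod_cast hy'.trans hn

/-- The asymptotic dimension is monotone under coarse embeddings. -/
theorem AsdimLE.of_coarseEmbedding {X Y : Type u} [MetricSpace X] [MetricSpace Y] (φ : Y → X)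
    (h₁ : ∀ R, ∃ R', ∀ y y', dist y y' ≤ R → dist (φ y) (φ y') ≤ R')
    (h₂ : ∀ R, ∃ R', ∀ y y', dist (φ y) (φ y') ≤ R → dist y y' ≤ R') {n : ℕ}
    (h : AsdimLE X n) : AsdimLE Y n := by
  intro R _
  obtain ⟨R', hR'⟩ := h₁ R
  -- The maximum with `1` is there because `R'` may fail to be positive.
  obtain ⟨U, D, hcov, hbdd, hsep⟩ := h (max R' 1) (by positivity)
  obtain ⟨D', hD'⟩ := h₂ D
  refine ⟨fun i => (φ ⁻¹' ·) '' U i, D', fun y => ?_, ?_, ?_⟩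
  · obtain ⟨i, A, hA, hy⟩ := hcov (φ y)
    exact ⟨i, _, ⟨A, hA, rfl⟩, hy⟩
  · rintro i _ ⟨A, hA, rfl⟩ x hx y hy
    exact hD' x y (hbdd i A hA _ hx _ hy)
  · rintro i _ ⟨A, hA, rfl⟩ _ ⟨B, hB, rfl⟩ hAB x hx y hy
    by_contra! hxy
    have hne : A ≠ B := fun h => hAB (h ▸ rfl)
    exact absurd ((hR' x y hxy).trans (le_max_left R' 1))
      (hsep i A hA B hB hne _ hx _ hy).not_ge

theorem groupAsymptoticDimension_lt_top_iff (G : Type u) [Group G] :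
    groupAsymptoticDimension G < ⊤ ↔
      ∃ m, IsProperLeftInvariantMetric G m ∧ ∃ n, @AsdimLE G m n := by
  simp [groupAsymptoticDimension, asymptoticDimension, iInf_lt_iff]

namespace IsProperLeftInvariantMetric

variable {G : Type u} [Group G] {m : MetricSpace G}

theorem exists_dist_le (hm : IsProperLeftInvariantMetric G m) {B : Set G} (hB : B.Finite) :
    ∃ R, ∀ x y : G, x⁻¹ * y ∈ B → dist x y ≤ R := by
  obtain ⟨R, hR⟩ := (hB.image fun b => dist 1 b).bddAbove
  refine ⟨R, fun x y hxy => ?_⟩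
  rw [← hm.left_invariant x⁻¹, inv_mul_cancel]
  exact hR ⟨_, hxy, rfl⟩

theorem exists_finite (hm : IsProperLeftInvariantMetric G m) (R : ℝ) :
    ∃ B : Set G, B.Finite ∧ ∀ x y : G, dist x y ≤ R → x⁻¹ * y ∈ B := by
  refine ⟨_, hm.proper 1 R, fun x y hxy => ?_⟩
  change dist (x⁻¹ * y) 1 ≤ R
  rw [← hm.left_invariant x⁻¹, inv_mul_cancel] at hxy
  rwa [dist_comm]

end IsProperLeftInvariantMetric

open scoped Pointwise in
/-- Finiteness of the asymptotic dimension passes to finitely generated groups that contain a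
subgroup with finite index. -/
theorem groupAsymptoticDimension_lt_top_of_finiteIndex {N G Q : Type u} [Group N] [Group G]
    [Group Q] [Group.FG Q] {i : N →* G} (hi : Function.Injective i) {j : N →* Q}
    (hj : Function.Injective j) [j.range.FiniteIndex] (h : groupAsymptoticDimension G < ⊤) :
    groupAsymptoticDimension Q < ⊤ := by
  obtain ⟨m, hm, k, hk⟩ := (groupAsymptoticDimension_lt_top_iff G).mp h
  -- Without such a metric the infimum that defines the dimension of `Q` would be `⊤`; finite
  -- generation supplies one.
  obtain ⟨m', hm'⟩ := exists_isProperLeftInvariantMetric Q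
  obtain ⟨e, t, n, hn, -⟩ := exists_right_transversal j hj
  have hfin : Finite (Quotient (QuotientGroup.rightRel j.range)) :=
    Finite.of_equiv _ (QuotientGroup.quotientRightRelEquivQuotientLeftRel j.range).symm
  have hE : (Set.range e).Finite := Set.finite_range e
  have hmul : ∀ x y, x⁻¹ * y = (e (t x))⁻¹ * j ((n x)⁻¹ * n y) * e (t y) := fun x y => by
    conv_lhs => rw [hn x, hn y]
    simp [mul_assoc]
  -- Dropping the coset representative changes an element by one of finitely many factors, so `y ↦ i
  -- (n y)` is a coarse embedding of `Q` in `G`.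
  refine (groupAsymptoticDimension_lt_top_iff Q).mpr ⟨m', hm', k,
    AsdimLE.of_coarseEmbedding (fun y => i (n y)) (fun R => ?_) (fun R => ?_) hk⟩
  · obtain ⟨B, hB, hBR⟩ := hm'.exists_finite R
    have hB' : (j ⁻¹' (Set.range e * B * (Set.range e)⁻¹)).Finite :=
      ((hE.mul hB).mul hE.inv).preimage hj.injOn
    obtain ⟨R', hR'⟩ := hm.exists_dist_le (hB'.image i)
    refine ⟨R', fun x y hxy => hR' _ _ ⟨(n x)⁻¹ * n y, ?_, by simp⟩⟩
    refine ⟨_, ⟨_, ⟨t x, rfl⟩, _, hBR x y hxy, rfl⟩, (e (t y))⁻¹,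
      Set.inv_mem_inv.mpr ⟨t y, rfl⟩, ?_⟩
    rw [hmul]
    simp only [mul_assoc, mul_inv_cancel_left, mul_inv_cancel, mul_one]
  · obtain ⟨B, hB, hBR⟩ := hm.exists_finite R
    have hB' := (hB.preimage hi.injOn).image j
    obtain ⟨R', hR'⟩ := hm'.exists_dist_le ((hE.inv.mul hB').mul hE)
    refine ⟨R', fun x y hxy => hR' _ _ ?_⟩
    rw [hmul]
    refine Set.mul_mem_mul (Set.mul_mem_mul (Set.inv_mem_inv.mpr ⟨_, rfl⟩) ⟨_, ?_, rfl⟩) ⟨_, rfl⟩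
    rw [Set.mem_preimage, map_mul, map_inv]
    exact hBR _ _ hxy

end Asdim

/-! ### Reduced centralizers -/

/-- A central element that an integral character detects virtually splits off. -/
theorem exists_virtual_splitting {G : Type u} [Group G] {g : G}
    (φ : Subgroup.centralizer ({g} : Set G) →* Multiplicative ℤ)
    (hφ : ∀ c : Subgroup.centralizer ({g} : Set G), (c : G) = g → φ c ≠ 1) :
    ∃ j : φ.ker →* ReducedCentralizer g, Function.Injective j ∧ j.range.FiniteIndex := by
  set γ : Subgroup.centralizer ({g} : Set G) :=
    ⟨g, Subgroup.mem_centralizer_singleton_iff.mpr rfl⟩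
  have hγ : φ γ ≠ 1 := hφ γ rfl
  set π := QuotientGroup.mk' (zpowersInCentralizer g)
  have hπ : ∀ c, π c = 1 ↔ ∃ k : ℤ, γ ^ k = c := fun c => by
    rw [← MonoidHom.mem_ker, QuotientGroup.ker_mk', Subgroup.mem_subgroupOf,
      Subgroup.mem_zpowers_iff]
    exact exists_congr fun k => ⟨fun h => Subtype.ext h, fun h => congrArg Subtype.val h⟩
  refine ⟨π.comp φ.ker.subtype, (injective_iff_map_eq_one _).mpr fun c hc => ?_, ?_⟩
  · obtain ⟨k, hk⟩ := (hπ c).mp hc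
    have h₁ : φ γ ^ k = 1 := by rw [← map_zpow, hk]; exact c.2
    have h₂ : k = 0 := (smul_eq_zero.mp
      (show k • Multiplicative.toAdd (φ γ) = 0 from h₁)).resolve_right hγ
    rw [h₂, zpow_zero] at hk
    exact Subtype.ext hk.symm
  · have hZ : (Subgroup.zpowers (φ γ)).FiniteIndex := by
      have h₁ : Subgroup.zpowers (φ γ)
          = AddSubgroup.toSubgroup (AddSubgroup.zmultiples (Multiplicative.toAdd (φ γ))) := by
        ext x
        simp only [Subgroup.mem_zpowers_iff]
        rfl
      rw [h₁, AddSubgroup.finiteIndex_toSubgroup_iff, AddSubgroup.finiteIndex_iff,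
        Int.index_zmultiples]
      exact Int.natAbs_ne_zero.mpr hγ
    have hcomap : ((Subgroup.zpowers (φ γ)).comap φ).FiniteIndex := by
      rw [Subgroup.finiteIndex_iff, Subgroup.index_comap]
      exact Subgroup.isFiniteRelIndex_iff_relIndex_ne_zero.mp
        (Subgroup.isFiniteRelIndex_of_finiteIndex)
    -- If `φ c` is a power of `φ γ`, dividing `c` by that power of `γ` lands in the kernel without
    -- changing the class of `c`.
    have hle : (Subgroup.zpowers (φ γ)).comap φ ≤ (π.comp φ.ker.subtype).range.comap π := by
      intro c hc
      obtain ⟨k, hk⟩ := Subgroup.mem_zpowers_iff.mp (Subgroup.mem_comap.mp hc)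
      refine ⟨⟨c * (γ ^ k)⁻¹, ?_⟩, ?_⟩
      · rw [MonoidHom.mem_ker, map_mul, map_inv, map_zpow, hk, mul_inv_cancel]
      · change π (c * (γ ^ k)⁻¹) = π c
        rw [map_mul, map_inv, (hπ (γ ^ k)).mpr ⟨k, rfl⟩, inv_one, mul_one]
    have hfi := Subgroup.finiteIndex_of_le hle
    refine ⟨fun h0 => hfi.index_ne_zero ?_⟩
    rwa [Subgroup.index_comap_of_surjective _ (QuotientGroup.mk'_surjective _)]

theorem mainTheorem4 {G : Type u} {X : Type v} [Group G] [MetricSpace X] [MulAction G X]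
    (hX : IsCAT0 X) (hG : IsGeometricAction G X) (g : G) (hg : ¬ IsOfFinOrder g) :
    (∃ H : Subgroup (ReducedCentralizer g), H.FiniteIndex ∧
      ∃ f : H →* Subgroup.centralizer ({g} : Set G), Function.Injective f) ∧
    (homologicalDimension ℚ G < ⊤ → homologicalDimension ℚ (ReducedCentralizer g) < ⊤) ∧
    (groupAsymptoticDimension G < ⊤ → groupAsymptoticDimension (ReducedCentralizer g) < ⊤) := by
  obtain ⟨p, hp⟩ := hG.exists_isCoarselyGeometric hX
  -- Finite generation serves twice: to make the real character integral, and to put a word metric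
  -- on the reduced centralizer.
  have hfg : Group.FG (Subgroup.centralizer ({g} : Set G)) :=
    hp.fg_centralizer hX.exists_cnMidpoint g
  obtain ⟨τ, hτ⟩ := hp.exists_translation_hom hX.exists_cnMidpoint hg
  obtain ⟨φ, hφ⟩ := exists_int_hom_of_real_hom τ
    (hτ ⟨g, Subgroup.mem_centralizer_singleton_iff.mpr rfl⟩ rfl)
  obtain ⟨j, hj, hjfin⟩ := exists_virtual_splitting φ fun c hc => by
    rwa [show c = ⟨g, Subgroup.mem_centralizer_singleton_iff.mpr rfl⟩ from Subtype.ext hc]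
  have hi : Function.Injective ((Subgroup.centralizer ({g} : Set G)).subtype.comp φ.ker.subtype) :=
    (Subgroup.subtype_injective _).comp (Subgroup.subtype_injective _)
  refine ⟨⟨j.range, hjfin, φ.ker.subtype.comp (MonoidHom.ofInjective hj).symm.toMonoidHom,
    (Subgroup.subtype_injective _).comp (MulEquiv.injective _)⟩,
    homologicalDimension_lt_top_of_finiteIndex hi hj,
    groupAsymptoticDimension_lt_top_of_finiteIndex hi hj⟩
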